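/- Let $1<\alpha<2$, $0<\gamma<1$, $x_R>0$, $T>0$, and put $\sigma=\frac{\gamma}{1-\gamma}$, $\kappa_\alpha=-\frac{1}{2\cos(\alpha\pi/2)}>0$. Let $u$ be a classical solution of $${}^{CF}_{\;\;0}D_t^{\gamma}u(x,t)=\frac{\partial^\alpha u(x,t)}{\partial|x|^\alpha}+f(x,t),\qquad (x,t)\in(0,x_R)\times(0,T],$$ with $u(x,0)=u_0(x)$ for $0<x<x_R$ (the initial value $u_0$ need not vanish) and $u(0,t)=u(x_R,t)=0$ for $0\le t\le T$. Here $${}^{CF}_{\;\;0}D_t^{\gamma}v(t)=\frac1{1-\gamma}\int_0^t v'(s)e^{-\sigma(t-s)}\,ds$$ is the Caputo–Fabrizio derivative, and $$\frac{\partial^\alpha v(x)}{\partial|x|^\alpha}=\frac{\kappa_\alpha}{\Gamma(2-\alpha)}\frac{d^2}{dx^2}\left(\int_0^x(x-\xi)^{1-\alpha}v(\xi)\,d\xi+\int_x^{x_R}(\xi-x)^{1-\alpha}v(\xi)\,d\xi\right)$$ is the Riesz derivative. "Classical" means that $u(\cdot,t)$ is continuous on $[0,x_R]$ for $0\le t\le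 T$; that for each $x\in(0,x_R)$, $u(x,\cdot)$ is continuous on $[0,T]$ and differentiable on $(0,T)$ with integrable derivative; and that for each $t\in(0,T]$ each of the two integrals above, with $v=u(\cdot,t)$, is twice continuously differentiable in $x\in(0,x_R)$. Let $N_x,N\ge1$ be integers and $\tau>0$ with $N\tau\le T$. Put $\Delta x=x_R/N_x$, $x_i=i\Delta x$, $t_n=n\tau$, $f_i^n=f(x_i,t_n)$. Let $$g_0^\alpha=1,\quad g_1^\alpha=-4+2^{3-\alpha},\quad g_2^\alpha=6-2^{5-\alpha}+3^{3-\alpha},$$ $$g_m^\alpha=(m+1)^{3-\alpha}-4m^{3-\alpha}+6(m-1)^{3-\alpha}-4(m-2)^{3-\alpha}+(m-3)^{3-\alpha}\quad(m\ge3),$$ and $g^\alpha_{i,i}=2g_1^\alpha$, $g^\alpha_{i,m}=g_0^\alpha+g_2^\alpha$ if $|i-m|=1$, $g^\alpha_{i,m}=g^\alpha_{|i-m|+1}$ if $|i-m|\ge2$. A grid function $(u_i^n)_{0\le i\le N_x,\,0\le n\le N}$ is computed by the scheme if $u_i^0=u_0(x_i)$ for $1\le i\le N_x-1$, $u_0^n=u_{N_x}^n=0$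 for $0\le n\le N$, and for $1\le n\le N$, $1\le i\le N_x-1$ $$\frac{1}{(1-\gamma)\sigma\tau}\Big[u_i^n(1-e^{-\sigma\tau})-\sum_{k=1}^{n-1}u_i^k e^{-\sigma(n-1-k)\tau}(1-e^{-\sigma\tau})^2\Big]$$ $$=\frac{\kappa_\alpha}{\Gamma(4-\alpha)(\Delta x)^\alpha}\sum_{m=0}^{N_x}g^\alpha_{i,m}u_m^n+f_i^n+\frac{1}{(1-\gamma)\sigma\tau}u_i^0(1-e^{-\sigma\tau})e^{-\sigma(n-1)\tau}.$$ The local truncation error is $$r_i^n=\frac1{1-\gamma}\sum_{k=1}^n\frac{u(x_i,t_k)-u(x_i,t_{k-1})}{\sigma\tau}e^{-\sigma(n-k)\tau}(1-e^{-\sigma\tau})-\frac{\kappa_\alpha}{\Gamma(4-\alpha)(\Delta x)^\alpha}\sum_{m=0}^{N_x}g^\alpha_{i,m}u(x_m,t_n)-f_i^n,$$ and we consider constants $C_u>0$ with $$|r_i^n|\le C_u\big(\tau^2+(\Delta x)^2\big)\qquad(1\le n\le N,\ 1\le i\le N_x-1).\tag{$*$}$$ For a grid function $v$ let $\|v\|=\big(\Delta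 x\sum_{i=0}^{N_x-1}v_i^2\big)^{1/2}$. Then: (a) If $u$ is sufficiently smooth, then there is a constant $C_u>0$, independent of $\tau,N,N_x$, such that $(*)$ holds for all $N_x,N\ge1$ and all $\tau>0$ with $N\tau\le T$. Here sufficiently smooth means that for some constant $K$, for every $x\in[0,x_R]$, $u(x,\cdot)$ is $C^1$ on $[0,T]$ with $K$-Lipschitz derivative, and, for every $t\in[0,T]$, the extension of $u(\cdot,t)$ by zero outside $[0,x_R]$ is $C^3$ on $\mathbb R$ with $K$-Lipschitz third derivative. (b) Whenever $C_u>0$ satisfies $(*)$ on a grid as above, every solution $(u_i^n)$ of the scheme on that grid satisfies, with $\varepsilon_i^n=u(x_i,t_n)-u_i^n$, $$\tau\sum_{n=1}^N\|\varepsilon^n\|\le\frac{|\Gamma(1-\alpha)|\,\Gamma(4-\alpha)\,x_R^{\alpha+1/2}\,T}{\sqrt2\,\kappa_\alpha}\,C_u\big(\tau^2+(\Delta x)^2\big).$$ -/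

import Mathlib

noncomputable section

namespace CFRiesz

open Set

/-! ### The continuous problem -/

/-- `σ = γ / (1 - γ)`. -/
def sigma (γ : ℝ) : ℝ := γ / (1 - γ)

/-- `κ_α = -1 / (2 cos (α π / 2))`, positive for `1 < α < 2`. -/
def kappa (α : ℝ) : ℝ := -1 / (2 * Real.cos (α * Real.pi / 2))

/-- The Caputo-Fabrizio derivative of order `γ` at time `t`:
`(1 / (1 - γ)) ∫_0^t v'(s) e^{-σ (t - s)} ds`. -/
def cfDeriv (γ : ℝ) (v : ℝ → ℝ) (t : ℝ) : ℝ :=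
  1 / (1 - γ) * ∫ s in (0 : ℝ)..t, deriv v s * Real.exp (-sigma γ * (t - s))

/-- `∫_0^x (x - ξ)^{1 - α} v(ξ) dξ`. -/
def leftInt (α : ℝ) (v : ℝ → ℝ) (x : ℝ) : ℝ :=
  ∫ ξ in (0 : ℝ)..x, (x - ξ) ^ (1 - α) * v ξ

/-- `∫_x^{x_R} (ξ - x)^{1 - α} v(ξ) dξ`. -/
def rightInt (α xR : ℝ) (v : ℝ → ℝ) (x : ℝ) : ℝ :=
  ∫ ξ in x..xR, (ξ - x) ^ (1 - α) * v ξ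

/-- The left Riemann-Liouville derivative of order `α ∈ (1, 2)` on `(0, x_R)`. -/
def leftRL (α : ℝ) (v : ℝ → ℝ) (x : ℝ) : ℝ :=
  1 / Real.Gamma (2 - α) * iteratedDeriv 2 (leftInt α v) x

/-- The right Riemann-Liouville derivative of order `α ∈ (1, 2)` on `(0, x_R)`. -/
def rightRL (α xR : ℝ) (v : ℝ → ℝ) (x : ℝ) : ℝ :=
  1 / Real.Gamma (2 - α) * iteratedDeriv 2 (rightInt α xR v) x

/-- The Riesz derivative `κ_α (₀D_x^α + _xD_{x_R}^α) v` at `x`. -/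
def rieszDeriv (α xR : ℝ) (v : ℝ → ℝ) (x : ℝ) : ℝ :=
  kappa α * (leftRL α v x + rightRL α xR v x)

/-- `u x t` is a classical solution of the initial-boundary value problem
`CF D_t^γ u = ∂^α u / ∂|x|^α + f` on `(0, x_R) × (0, T]`, `u(x, 0) = u₀(x)`,
`u(0, t) = u(x_R, t) = 0`.  The first four fields say that all the derivatives and integrals
in the equation exist in the ordinary sense. -/
structure IsSolution (α γ xR T : ℝ) (f : ℝ → ℝ → ℝ) (u₀ : ℝ → ℝ) (u : ℝ → ℝ → ℝ) : Prop where
  continuousOn_space : ∀ t ∈ Icc 0 T, ContinuousOn (fun x => u x t) (Icc 0 xR)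
  continuousOn_time : ∀ x ∈ Ioo 0 xR, ContinuousOn (u x) (Icc 0 T)
  time_deriv : ∀ x ∈ Ioo 0 xR, DifferentiableOn ℝ (u x) (Ioo 0 T) ∧
    IntervalIntegrable (deriv (u x)) MeasureTheory.volume 0 T
  space_deriv : ∀ t ∈ Ioc 0 T, ContDiffOn ℝ 2 (leftInt α (fun x => u x t)) (Ioo 0 xR) ∧
    ContDiffOn ℝ 2 (rightInt α xR (fun x => u x t)) (Ioo 0 xR)
  equation : ∀ x ∈ Ioo 0 xR, ∀ t ∈ Ioc 0 T,
    cfDeriv γ (u x) t = rieszDeriv α xR (fun y => u y t) x + f x t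
  initial : ∀ x ∈ Ioo 0 xR, u x 0 = u₀ x
  boundary : ∀ t ∈ Icc 0 T, u 0 t = 0 ∧ u xR t = 0

/-- Sufficient smoothness, with one constant `K` for the whole space-time cylinder: `u` is
continuously differentiable in time on `[0, T]` with `K`-Lipschitz derivative, and the extension
of `u` by zero outside `[0, x_R]` is three times continuously differentiable in space with
`K`-Lipschitz third derivative. -/
def IsSmooth (xR T : ℝ) (u : ℝ → ℝ → ℝ) : Prop :=
  ∃ K : NNReal,
    (∀ x ∈ Icc 0 xR, ContDiffOn ℝ 1 (u x) (Icc 0 T) ∧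
      LipschitzOnWith K (derivWithin (u x) (Icc 0 T)) (Icc 0 T)) ∧
    (∀ t ∈ Icc 0 T, ContDiff ℝ 3 ((Icc 0 xR).indicator (fun x => u x t)) ∧
      LipschitzWith K (iteratedDeriv 3 ((Icc 0 xR).indicator (fun x => u x t))))

/-! ### The difference scheme -/

/-- The coefficients `g^α_m`. -/
def g (α : ℝ) : ℕ → ℝ
  | 0 => 1
  | 1 => -4 + 2 ^ (3 - α)
  | 2 => 6 - 2 ^ (5 - α) + 3 ^ (3 - α)
  | (m + 3) => ((m : ℝ) + 4) ^ (3 - α) - 4 * ((m : ℝ) + 3) ^ (3 - α)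
      + 6 * ((m : ℝ) + 2) ^ (3 - α) - 4 * ((m : ℝ) + 1) ^ (3 - α) + (m : ℝ) ^ (3 - α)

/-- The coefficients `g^α_{i,m}`. -/
def g₂ (α : ℝ) (i m : ℕ) : ℝ :=
  if m + 1 < i then g α (i - m + 1)
  else if m + 1 = i then g α 0 + g α 2
  else if m = i then 2 * g α 1
  else if m = i + 1 then g α 0 + g α 2
  else g α (m - i + 1)

/-- The discrete Riesz operator
`κ_α / (Γ(4 - α) Δx^α) ∑_{m=0}^{N_x} g^α_{i,m} v_m`, with `Δx = h`. -/
def discRiesz (α h : ℝ) (Nx : ℕ) (v : ℕ → ℝ) (i : ℕ) : ℝ :=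
  kappa α / (Real.Gamma (4 - α) * h ^ α) * ∑ m ∈ Finset.range (Nx + 1), g₂ α i m * v m

/-- The discrete Caputo-Fabrizio operator
`(1 / (1 - γ)) ∑_{k=1}^n (v^k - v^{k-1}) / (σ τ) e^{-σ (n - k) τ} (1 - e^{-σ τ})`. -/
def discCF (γ τ : ℝ) (v : ℕ → ℝ) (n : ℕ) : ℝ :=
  1 / (1 - γ) * ∑ k ∈ Finset.Icc 1 n, (v k - v (k - 1)) / (sigma γ * τ)
    * Real.exp (-sigma γ * ((n : ℝ) - k) * τ) * (1 - Real.exp (-sigma γ * τ))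

/-- The local truncation error `r_i^n` of the exact solution `u` on the grid
`x_i = i Δx`, `t_n = n τ`, `Δx = x_R / N_x`. -/
def truncErr (α γ xR : ℝ) (f u : ℝ → ℝ → ℝ) (τ : ℝ) (Nx n i : ℕ) : ℝ :=
  discCF γ τ (fun k => u (i * (xR / Nx)) (k * τ)) n
    - discRiesz α (xR / Nx) Nx (fun m => u (m * (xR / Nx)) (n * τ)) i
    - f (i * (xR / Nx)) (n * τ)

/-- `|r_i^n| ≤ C (τ² + Δx²)` at all interior grid points with `1 ≤ n ≤ N`. -/
def TruncBound (α γ xR : ℝ) (f u : ℝ → ℝ → ℝ) (C τ : ℝ) (Nx N : ℕ) : Prop :=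
  ∀ n ∈ Finset.Icc 1 N, ∀ i ∈ Finset.Ico 1 Nx,
    |truncErr α γ xR f u τ Nx n i| ≤ C * (τ ^ 2 + (xR / Nx) ^ 2)

/-- `U n i = u_i^n` (`0 ≤ n ≤ N`, `0 ≤ i ≤ N_x`) is computed by the difference scheme from the
initial values `u₀(x_i)`, with homogeneous Dirichlet boundary values. -/
structure IsSchemeSolution (α γ xR : ℝ) (f : ℝ → ℝ → ℝ) (u₀ : ℝ → ℝ) (τ : ℝ) (Nx N : ℕ)
    (U : ℕ → ℕ → ℝ) : Prop where
  equation : ∀ n ∈ Finset.Icc 1 N, ∀ i ∈ Finset.Ico 1 Nx,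
    1 / ((1 - γ) * sigma γ * τ) *
        (U n i * (1 - Real.exp (-sigma γ * τ))
          - ∑ k ∈ Finset.Ico 1 n, U k i * Real.exp (-sigma γ * ((n : ℝ) - 1 - k) * τ)
              * (1 - Real.exp (-sigma γ * τ)) ^ 2)
      = discRiesz α (xR / Nx) Nx (U n) i + f (i * (xR / Nx)) (n * τ)
        + 1 / ((1 - γ) * sigma γ * τ) * U 0 i * (1 - Real.exp (-sigma γ * τ))
            * Real.exp (-sigma γ * ((n : ℝ) - 1) * τ)
  initial : ∀ i ∈ Finset.Ico 1 Nx, U 0 i = u₀ (i * (xR / Nx))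
  boundary : ∀ n ≤ N, U n 0 = 0 ∧ U n Nx = 0

/-- The discrete inner product `Δx ∑_{i=0}^{N_x - 1} v_i w_i`, with `Δx = h`. -/
def gridInner (h : ℝ) (Nx : ℕ) (v w : ℕ → ℝ) : ℝ :=
  h * ∑ i ∈ Finset.range Nx, v i * w i

/-- The discrete `L²` norm. -/
def gridNorm (h : ℝ) (Nx : ℕ) (v : ℕ → ℝ) : ℝ := √(gridInner h Nx v v)

end CFRiesz

end

noncomputable section

namespace CFRiesz

open scoped Topology

/-! Error bound. Summation by parts shows that the scheme is the truncation error equation with zero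
right-hand side, so the error `e` satisfies `discCF e - discRiesz e = r`. It vanishes at time zero,
whatever `u₀` is, and at both ends of the interval. Test this equation with `e` and sum over space
and time. The memory term contributes a nonnegative amount (`sum_expSum_mul_nonneg`). The matrix
`g₂` is symmetric with nonnegative off-diagonal entries and row sums at most `-2(3-α)(2-α)(α-1)
N^(-α)`, where `N` is the number of space cells; hence `-discRiesz` is coercive uniformly in the
grid (`sum_mul_discRiesz_le`). Young's inequality then bounds the sum of squares of `e`
(`sum_sq_le`), and Cauchy-Schwarz in time gives the bound.

Consistency. In time, `discCF` replaces `v'` by its mean on each cell and integrates the exponential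
exactly; since the deviation from the mean integrates to zero, each cell costs `O(τ³)`
(`abs_discCF_sub_cfDeriv_le`). In space, the smooth extension `w` by zero turns the Riesz derivative
into a multiple of `∫_0^R y^(1-α) (w''(x-y) + w''(x+y)) dy` (`rieszDeriv_eq`). The scheme integrates
the kernel exactly against the piecewise linear interpolant of second difference quotients of `w`:
the coefficients `g` are fourth differences of `|j|^(3-α)`, produced by summation by parts
(`sum_quadrature_eq`). Taylor bounds for `w` then give `O(Δx²)`. -/

/-! ### Mean value forms of finite differences of powers. -/

lemma exists_rpow_slope_eq {F F' : ℝ → ℝ} {x : ℝ} (hc : ContinuousOn F (Set.Ici x))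
    (hd : ∀ y, x < y → HasDerivAt F (F' y) y) : ∃ ξ ∈ Set.Ioo x (x + 1), F (x + 1) - F x = F' ξ := by
  obtain ⟨c, hc, h⟩ := exists_hasDerivAt_eq_slope F F' (lt_add_one x)
    (hc.mono Set.Icc_subset_Ici_self) (fun y hy => hd y hy.1)
  exact ⟨c, hc, by rw [h]; simp⟩

lemma hasDerivAt_add_rpow {y c β : ℝ} (h : 0 < y + c) :
    HasDerivAt (fun z : ℝ => (z + c) ^ β) (β * (y + c) ^ (β - 1)) y := by
  simpa using ((hasDerivAt_id y).add_const c).rpow_const (p := β) (Or.inl h.ne')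

lemma continuousOn_add_rpow {x c β : ℝ} (hc : 0 ≤ c) (h : 0 < x ∨ 0 ≤ x ∧ 0 ≤ β) :
    ContinuousOn (fun z : ℝ => (z + c) ^ β) (Set.Ici x) := by
  refine ContinuousOn.rpow_const (by fun_prop) fun z hz => ?_
  rcases h with h | h
  · left
    have : x ≤ z := hz
    linarith
  · exact Or.inr h.2

lemma exists_rpow_diff_one {x β : ℝ} (h : 0 < x ∨ 0 ≤ x ∧ 0 ≤ β) :
    ∃ ξ ∈ Set.Ioo x (x + 1), (x + 1) ^ β - x ^ β = β * ξ ^ (β - 1) := by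
  have h0 : 0 ≤ x := by rcases h with h | h <;> [exact h.le; exact h.1]
  have := exists_rpow_slope_eq (x := x) (F := fun z => (z + 0) ^ β)
    (F' := fun z => β * (z + 0) ^ (β - 1)) (continuousOn_add_rpow le_rfl h)
    (fun y hy => hasDerivAt_add_rpow (by linarith))
  simpa using this

/-- A difference is the unit increment of the difference of one order less, so one mean value step
lowers both the order and the exponent. The intermediate point is positive, so the lowered exponent
may be negative; only the starting point may be zero. -/
lemma exists_rpow_diff_two {x β : ℝ} (h : 0 < x ∨ 0 ≤ x ∧ 0 ≤ β) :
    ∃ ξ ∈ Set.Ioo x (x + 2), (x + 2) ^ β - 2 * (x + 1) ^ β + x ^ β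
      = β * (β - 1) * ξ ^ (β - 2) := by
  have h0 : 0 ≤ x := by rcases h with h | h <;> [exact h.le; exact h.1]
  obtain ⟨ξ, hξ, e⟩ := exists_rpow_slope_eq (x := x) (F := fun z => (z + 1) ^ β - (z + 0) ^ β)
    (F' := fun z => β * (z + 1) ^ (β - 1) - β * (z + 0) ^ (β - 1))
    ((continuousOn_add_rpow zero_le_one h).sub (continuousOn_add_rpow le_rfl h))
    (fun y hy => (hasDerivAt_add_rpow (by linarith)).sub (hasDerivAt_add_rpow (by linarith)))
  obtain ⟨η, hη, e'⟩ := exists_rpow_diff_one (x := ξ) (β := β - 1) (Or.inl (by linarith [hξ.1]))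
  refine ⟨η, ⟨by linarith [hξ.1, hη.1], by linarith [hξ.2, hη.2]⟩, ?_⟩
  simp only [add_zero, add_assoc] at e
  norm_num at e
  rw [show β - 1 - 1 = β - 2 by ring] at e'
  rw [mul_assoc, ← e']
  linarith

lemma exists_rpow_diff_three {x β : ℝ} (h : 0 < x ∨ 0 ≤ x ∧ 0 ≤ β) :
    ∃ ξ ∈ Set.Ioo x (x + 3), (x + 3) ^ β - 3 * (x + 2) ^ β + 3 * (x + 1) ^ β - x ^ β
      = β * (β - 1) * (β - 2) * ξ ^ (β - 3) := by
  have h0 : 0 ≤ x := by rcases h with h | h <;> [exact h.le; exact h.1]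
  obtain ⟨ξ, hξ, e⟩ := exists_rpow_slope_eq (x := x)
    (F := fun z => (z + 2) ^ β - 2 * (z + 1) ^ β + (z + 0) ^ β)
    (F' := fun z => β * (z + 2) ^ (β - 1) - 2 * (β * (z + 1) ^ (β - 1)) + β * (z + 0) ^ (β - 1))
    (((continuousOn_add_rpow zero_le_two h).sub
      ((continuousOn_add_rpow zero_le_one h).const_mul 2)).add (continuousOn_add_rpow le_rfl h))
    (fun y hy => ((hasDerivAt_add_rpow (by linarith)).sub
      ((hasDerivAt_add_rpow (by linarith)).const_mul 2)).add (hasDerivAt_add_rpow (by linarith)))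
  obtain ⟨η, hη, e'⟩ := exists_rpow_diff_two (x := ξ) (β := β - 1) (Or.inl (by linarith [hξ.1]))
  refine ⟨η, ⟨by linarith [hξ.1, hη.1], by linarith [hξ.2, hη.2]⟩, ?_⟩
  simp only [add_zero, add_assoc] at e
  norm_num at e
  rw [show β - 1 - 2 = β - 3 by ring, show β - 1 - 1 = β - 2 by ring] at e'
  rw [mul_assoc, mul_assoc, ← mul_assoc (β - 1), ← e']
  linarith

lemma exists_rpow_diff_four {x β : ℝ} (h : 0 < x ∨ 0 ≤ x ∧ 0 ≤ β) :
    ∃ ξ ∈ Set.Ioo x (x + 4),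
      (x + 4) ^ β - 4 * (x + 3) ^ β + 6 * (x + 2) ^ β - 4 * (x + 1) ^ β + x ^ β
      = β * (β - 1) * (β - 2) * (β - 3) * ξ ^ (β - 4) := by
  have h0 : 0 ≤ x := by rcases h with h | h <;> [exact h.le; exact h.1]
  obtain ⟨ξ, hξ, e⟩ := exists_rpow_slope_eq (x := x)
    (F := fun z => (z + 3) ^ β - 3 * (z + 2) ^ β + 3 * (z + 1) ^ β - (z + 0) ^ β)
    (F' := fun z => β * (z + 3) ^ (β - 1) - 3 * (β * (z + 2) ^ (β - 1))
      + 3 * (β * (z + 1) ^ (β - 1)) - β * (z + 0) ^ (β - 1))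
    ((((continuousOn_add_rpow zero_le_three h).sub
      ((continuousOn_add_rpow zero_le_two h).const_mul 3)).add
      ((continuousOn_add_rpow zero_le_one h).const_mul 3)).sub (continuousOn_add_rpow le_rfl h))
    (fun y hy => (((hasDerivAt_add_rpow (by linarith)).sub
      ((hasDerivAt_add_rpow (by linarith)).const_mul 3)).add
      ((hasDerivAt_add_rpow (by linarith)).const_mul 3)).sub (hasDerivAt_add_rpow (by linarith)))
  obtain ⟨η, hη, e'⟩ := exists_rpow_diff_three (x := ξ) (β := β - 1) (Or.inl (by linarith [hξ.1]))
  refine ⟨η, ⟨by linarith [hξ.1, hη.1], by linarith [hξ.2, hη.2]⟩, ?_⟩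
  simp only [add_zero, add_assoc] at e
  norm_num at e
  rw [show β - 1 - 3 = β - 4 by ring, show β - 1 - 1 = β - 2 by ring,
    show β - 1 - 2 = β - 3 by ring] at e'
  rw [show β * (β - 1) * (β - 2) * (β - 3) * η ^ (β - 4)
    = β * ((β - 1) * (β - 2) * (β - 3) * η ^ (β - 4)) by ring, ← e']
  linarith

/-! ### Signs, row sums and quadratic form of the scheme coefficients. -/

/-- The coefficient `g^α_{i,m}` with `|i - m| = j ≥ 1`. -/
def offDiag (α : ℝ) (j : ℕ) : ℝ := if j = 1 then g α 0 + g α 2 else g α (j + 1)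

lemma g₂_self (α : ℝ) (i : ℕ) : g₂ α i i = 2 * g α 1 := by simp [g₂]

lemma g₂_of_lt (α : ℝ) {i m : ℕ} (h : m < i) : g₂ α i m = offDiag α (i - m) := by
  unfold g₂ offDiag
  split_ifs <;> first | rfl | omega

lemma g₂_of_gt (α : ℝ) {i m : ℕ} (h : i < m) : g₂ α i m = offDiag α (m - i) := by
  unfold g₂ offDiag
  split_ifs <;> first | rfl | omega

lemma g₂_comm (α : ℝ) (i m : ℕ) : g₂ α i m = g₂ α m i := by
  rcases lt_trichotomy i m with h | rfl | h
  · rw [g₂_of_gt α h, g₂_of_lt α h]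
  · rfl
  · rw [g₂_of_gt α h, g₂_of_lt α h]

lemma two_rpow_five_sub (α : ℝ) : (2 : ℝ) ^ (5 - α) = 4 * 2 ^ (3 - α) := by
  rw [show (5 : ℝ) - α = 2 + (3 - α) by ring, Real.rpow_add two_pos]
  norm_num

/-- For `β = 3 - α` in `(1, 2)` the factor `β(β-1)(β-2)(β-3)` of the fourth difference is positive.
-/
lemma g_nonneg {α : ℝ} (hα : 1 < α) (hα' : α < 2) (m : ℕ) : 0 ≤ g α (m + 3) := by
  obtain ⟨ξ, hξ, e⟩ := exists_rpow_diff_four (x := (m : ℝ)) (β := 3 - α)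
    (Or.inr ⟨by positivity, by linarith⟩)
  rw [g, e]
  have : 0 < ξ := lt_of_le_of_lt (by positivity) hξ.1
  have h1 : 0 ≤ (3 - α) * (3 - α - 1) * ((2 - (3 - α)) * (3 - (3 - α))) := by
    apply mul_nonneg <;> apply mul_nonneg <;> linarith
  have := Real.rpow_nonneg this.le (3 - α - 4)
  nlinarith

/-- This is the fourth difference of `|j|^(3-α)` centred at `1`; its stencil straddles the kink at
`0`, so the mean value form is not available. With `t = 2^(1-α) ≤ 1` the value is `7 - 16 t + 9 ·
3^(1-α)`, at least `8/5 · (1 - t)` by Bernoulli's inequality. -/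
lemma g_zero_add_g_two_nonneg {α : ℝ} (hα : 1 < α) : 0 ≤ g α 0 + g α 2 := by
  have key : (3 : ℝ) ^ (1 - α) ≥ 1 + 8 / 5 * ((2 : ℝ) ^ (1 - α) - 1) := by
    -- The exponent `8/5` comes from `3 ≤ 2^(8/5)`, that is `3^5 = 243 ≤ 256 = 2^8`.
    have h1 : ((2 : ℝ) ^ (1 - α)) ^ (8 / 5 : ℝ) ≤ 3 ^ (1 - α) := by
      rw [← Real.rpow_mul two_pos.le, mul_comm, Real.rpow_mul two_pos.le]
      apply Real.rpow_le_rpow_of_nonpos (by norm_num) _ (by linarith)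
      rw [show (8 / 5 : ℝ) = 8 * 5⁻¹ by norm_num, Real.rpow_mul two_pos.le]
      rw [Real.le_rpow_inv_iff_of_pos (by norm_num) (by norm_num) (by norm_num)]
      norm_num
    have h2 := one_add_mul_self_le_rpow_one_add (s := (2 : ℝ) ^ (1 - α) - 1) (p := 8 / 5)
      (by linarith [Real.rpow_pos_of_pos two_pos (1 - α)]) (by norm_num)
    rw [add_sub_cancel] at h2
    linarith
  have h2 : (2 : ℝ) ^ (1 - α) ≤ 1 := Real.rpow_le_one_of_one_le_of_nonpos (by norm_num) (by linarith)
  have e2 : (2 : ℝ) ^ (3 - α) = 4 * 2 ^ (1 - α) := by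
    rw [show (3 : ℝ) - α = 2 + (1 - α) by ring, Real.rpow_add two_pos]; norm_num
  have e3 : (3 : ℝ) ^ (3 - α) = 9 * 3 ^ (1 - α) := by
    rw [show (3 : ℝ) - α = 2 + (1 - α) by ring, Real.rpow_add three_pos]; norm_num
  simp only [g]
  rw [two_rpow_five_sub, e2, e3]
  linarith

lemma offDiag_nonneg {α : ℝ} (hα : 1 < α) (hα' : α < 2) {j : ℕ} (hj : 1 ≤ j) :
    0 ≤ offDiag α j := by
  unfold offDiag
  split_ifs with h
  · exact g_zero_add_g_two_nonneg hα
  · obtain ⟨k, rfl⟩ : ∃ k, j = k + 2 := ⟨j - 2, by omega⟩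
    exact g_nonneg hα hα' k

/-- Half of the row sum of `g^α_{i,m}`: the half diagonal and `i - 1` entries on one side. -/
def halfRow (α : ℝ) (i : ℕ) : ℝ := g α 1 + ∑ j ∈ Finset.Ico 1 i, offDiag α j

lemma halfRow_add_two (α : ℝ) (n : ℕ) (hα : α < 3) : halfRow α (n + 2) =
    ((n : ℝ) + 3) ^ (3 - α) - 3 * ((n : ℝ) + 2) ^ (3 - α) + 3 * ((n : ℝ) + 1) ^ (3 - α)
      - (n : ℝ) ^ (3 - α) := by
  induction n with
  | zero =>
    simp [halfRow, offDiag, g, two_rpow_five_sub, Real.zero_rpow (show 3 - α ≠ 0 by linarith)]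
    ring
  | succ n ih =>
    have : halfRow α (n + 1 + 2) = halfRow α (n + 2) + offDiag α (n + 2) := by
      simp only [halfRow]
      rw [Finset.sum_Ico_succ_top (by omega)]
      ring
    rw [this, ih, offDiag, if_neg (by omega), show n + 2 + 1 = n + 3 by rfl, g]
    push_cast
    rw [show (n : ℝ) + 1 + 3 = n + 4 by ring, show (n : ℝ) + 1 + 2 = n + 3 by ring,
      show (n : ℝ) + 1 + 1 = n + 2 by ring]
    ring

/-- Fourth differences telescope to a third difference, equal to `(3-α)(2-α)(1-α) ξ^(-α)` with `ξ <
i + 1`. For `i = 1` only the half diagonal `2^(3-α) - 4` is present, and Bernoulli's inequality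
replaces the mean value form. -/
lemma halfRow_le {α : ℝ} (hα : 1 < α) (hα' : α < 2) {i : ℕ} (hi : 1 ≤ i) :
    halfRow α i ≤ -((3 - α) * (2 - α) * (α - 1) * ((i : ℝ) + 1) ^ (-α)) := by
  obtain rfl | ⟨n, rfl⟩ : i = 1 ∨ ∃ n, i = n + 2 := by
    rcases i with _ | _ | n
    · omega
    · left; rfl
    · right; exact ⟨n, rfl⟩
  · have h2 : (2 : ℝ) ^ (3 - α) ≤ 4 - (α - 1) := by
      have := rpow_one_add_le_one_add_mul_self (s := (1 : ℝ)) (p := 2 - α) (by norm_num)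
        (by linarith) (by linarith)
      rw [show (3 : ℝ) - α = 1 + (2 - α) by ring, Real.rpow_add two_pos, Real.rpow_one]
      norm_num at this
      linarith
    have h3 : (2 : ℝ) ^ (-α) ≤ 1 / 2 := by
      calc (2 : ℝ) ^ (-α) ≤ 2 ^ (-1 : ℝ) :=
            Real.rpow_le_rpow_of_exponent_le (by norm_num) (by linarith)
        _ = 1 / 2 := by rw [Real.rpow_neg_one]; norm_num
    have h4 : (3 - α) * (2 - α) * (α - 1) ≤ 2 * (α - 1) := by
      apply mul_le_mul_of_nonneg_right _ (by linarith)
      nlinarith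
    have h5 : (3 - α) * (2 - α) * (α - 1) * (2 : ℝ) ^ (-α) ≤ 2 * (α - 1) * (1 / 2) :=
      mul_le_mul h4 h3 (by positivity) (by linarith)
    simp only [halfRow, g]
    norm_num
    linarith
  · obtain ⟨ξ, hξ, e⟩ := exists_rpow_diff_three (x := (n : ℝ)) (β := 3 - α)
      (Or.inr ⟨by positivity, by linarith⟩)
    have hξ0 : 0 < ξ := lt_of_le_of_lt (by positivity) hξ.1
    rw [halfRow_add_two α n (by linarith), e, show 3 - α - 3 = -α by ring]
    have h1 : ((n + 2 : ℕ) + 1 : ℝ) ^ (-α) ≤ ξ ^ (-α) := by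
      apply Real.rpow_le_rpow_of_nonpos hξ0 _ (by linarith)
      push_cast
      linarith [hξ.2]
    have h2 : 0 ≤ (3 - α) * (2 - α) * (α - 1) := by
      apply mul_nonneg _ (by linarith)
      apply mul_nonneg <;> linarith
    have := mul_le_mul_of_nonneg_left h1 h2
    calc _ = -((3 - α) * (2 - α) * (α - 1) * ξ ^ (-α)) := by ring
      _ ≤ _ := by linarith

lemma sum_g₂_row (α : ℝ) {i N : ℕ} (hi : i ∈ Finset.Ico 1 N) :
    ∑ m ∈ Finset.Ico 1 N, g₂ α i m = halfRow α i + halfRow α (N - i) := by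
  rw [Finset.mem_Ico] at hi
  rw [← Finset.sum_Ico_consecutive _ hi.1 hi.2.le, Finset.sum_eq_sum_Ico_succ_bot hi.2, g₂_self]
  have h1 : ∑ m ∈ Finset.Ico 1 i, g₂ α i m = ∑ j ∈ Finset.Ico 1 i, offDiag α j := by
    rw [Finset.sum_congr rfl fun m hm => g₂_of_lt α (Finset.mem_Ico.1 hm).2,
      Finset.sum_Ico_reflect _ _ (by omega)]
    simp
  have h2 : ∑ m ∈ Finset.Ico (i + 1) N, g₂ α i m = ∑ j ∈ Finset.Ico 1 (N - i), offDiag α j := by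
    rw [Finset.sum_congr rfl fun m hm =>
      g₂_of_gt α (show i < m from (Finset.mem_Ico.1 hm).1)]
    rw [Finset.sum_Ico_eq_sum_range, Finset.sum_Ico_eq_sum_range]
    apply Finset.sum_congr rfl
    intro k _
    congr 1
    omega
  rw [h1, h2, halfRow, halfRow]
  ring

lemma sum_g₂_row_le {α : ℝ} (hα : 1 < α) (hα' : α < 2) {i N : ℕ} (hi : i ∈ Finset.Ico 1 N) :
    ∑ m ∈ Finset.Ico 1 N, g₂ α i m
      ≤ -(2 * ((3 - α) * (2 - α) * (α - 1)) * (N : ℝ) ^ (-α)) := by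
  rw [sum_g₂_row α hi]
  rw [Finset.mem_Ico] at hi
  have h2 : 0 ≤ (3 - α) * (2 - α) * (α - 1) := by
    apply mul_nonneg _ (by linarith)
    apply mul_nonneg <;> linarith
  have aux : ∀ j : ℕ, 1 ≤ j → j + 1 ≤ N →
      halfRow α j ≤ -((3 - α) * (2 - α) * (α - 1) * (N : ℝ) ^ (-α)) := by
    intro j hj hN
    have : (N : ℝ) ^ (-α) ≤ ((j : ℝ) + 1) ^ (-α) :=
      Real.rpow_le_rpow_of_nonpos (by positivity) (by exact_mod_cast hN) (by linarith)
    have := mul_le_mul_of_nonneg_left this h2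
    linarith [halfRow_le hα hα' hj]
  linarith [aux i hi.1 (by omega), aux (N - i) (by omega) (by omega)]

/-- Off the diagonal the coefficients are nonnegative, so `v i * v m` may be replaced by `(v i ^ 2 +
v m ^ 2) / 2`; by symmetry only the row sums then remain. -/
lemma sum_g₂_mul_mul_le {α : ℝ} (hα : 1 < α) (hα' : α < 2) (N : ℕ) (v : ℕ → ℝ) :
    ∑ i ∈ Finset.Ico 1 N, v i * ∑ m ∈ Finset.Ico 1 N, g₂ α i m * v m
      ≤ -(2 * ((3 - α) * (2 - α) * (α - 1)) * (N : ℝ) ^ (-α))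
        * ∑ i ∈ Finset.Ico 1 N, v i ^ 2 := by
  have h1 : ∑ i ∈ Finset.Ico 1 N, v i * ∑ m ∈ Finset.Ico 1 N, g₂ α i m * v m
      ≤ ∑ i ∈ Finset.Ico 1 N, ∑ m ∈ Finset.Ico 1 N, g₂ α i m * ((v i ^ 2 + v m ^ 2) / 2) := by
    refine Finset.sum_le_sum fun i _ => ?_
    rw [Finset.mul_sum]
    refine Finset.sum_le_sum fun m _ => ?_
    by_cases h : i = m
    · subst h
      exact le_of_eq (by ring)
    · have hg : 0 ≤ g₂ α i m := by
        rcases lt_or_gt_of_ne h with h | h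
        · rw [g₂_of_gt α h]; exact offDiag_nonneg hα hα' (by omega)
        · rw [g₂_of_lt α h]; exact offDiag_nonneg hα hα' (by omega)
      nlinarith [sq_nonneg (v i - v m)]
  have h2 : ∑ i ∈ Finset.Ico 1 N, ∑ m ∈ Finset.Ico 1 N, g₂ α i m * ((v i ^ 2 + v m ^ 2) / 2)
      = ∑ i ∈ Finset.Ico 1 N, (∑ m ∈ Finset.Ico 1 N, g₂ α i m) * v i ^ 2 := by
    have e1 : ∑ i ∈ Finset.Ico 1 N, ∑ m ∈ Finset.Ico 1 N, g₂ α i m * v m ^ 2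
        = ∑ i ∈ Finset.Ico 1 N, ∑ m ∈ Finset.Ico 1 N, g₂ α i m * v i ^ 2 := by
      rw [Finset.sum_comm]
      simp_rw [g₂_comm α]
    have e2 : ∀ i m, g₂ α i m * ((v i ^ 2 + v m ^ 2) / 2)
        = (g₂ α i m * v i ^ 2 + g₂ α i m * v m ^ 2) / 2 := fun i m => by ring
    simp_rw [e2, ← Finset.sum_div, Finset.sum_add_distrib]
    rw [e1, Finset.sum_congr rfl fun i _ => Finset.sum_mul _ _ _]
    ring
  refine h1.trans (h2.le.trans ?_)
  rw [Finset.mul_sum]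
  exact Finset.sum_le_sum fun i hi =>
    mul_le_mul_of_nonneg_right (sum_g₂_row_le hα hα' hi) (sq_nonneg _)

/-! ### Positivity of the discrete memory term. -/

/-- `∑_{k=1}^n (v_k - v_{k-1}) q^{n-k}`. -/
def expSum (q : ℝ) (v : ℕ → ℝ) (n : ℕ) : ℝ :=
  ∑ k ∈ Finset.Icc 1 n, (v k - v (k - 1)) * q ^ (n - k)

lemma expSum_succ (q : ℝ) (v : ℕ → ℝ) (n : ℕ) :
    expSum q v (n + 1) = q * expSum q v n + (v (n + 1) - v n) := by
  unfold expSum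
  rw [Finset.sum_Icc_succ_top (by omega), Finset.mul_sum]
  congr 1
  · refine Finset.sum_congr rfl fun k hk => ?_
    rw [Nat.sub_add_comm (Finset.mem_Icc.1 hk).2, pow_succ]
    ring
  · simp

lemma expSum_sub (q : ℝ) (v w : ℕ → ℝ) (n : ℕ) :
    expSum q (fun k => v k - w k) n = expSum q v n - expSum q w n := by
  unfold expSum
  rw [← Finset.sum_sub_distrib]
  exact Finset.sum_congr rfl fun k _ => by ring

/-- Summation by parts for `expSum`. -/
lemma expSum_succ_eq (q : ℝ) (v : ℕ → ℝ) (n : ℕ) :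
    expSum q v (n + 1) = v (n + 1) - (1 - q) * ∑ k ∈ Finset.Ico 1 (n + 1), v k * q ^ (n - k)
      - v 0 * q ^ n := by
  induction n with
  | zero => simp [expSum]
  | succ n ih =>
    rw [expSum_succ, ih, Finset.sum_Ico_succ_top (by omega : 1 ≤ n + 1)]
    have : ∑ k ∈ Finset.Ico 1 (n + 1), v k * q ^ (n + 1 - k)
        = q * ∑ k ∈ Finset.Ico 1 (n + 1), v k * q ^ (n - k) := by
      rw [Finset.mul_sum]
      refine Finset.sum_congr rfl fun k hk => ?_
      rw [Nat.sub_add_comm (by have := (Finset.mem_Ico.1 hk).2; omega), pow_succ]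
      ring
    rw [this]
    simp only [Nat.sub_self, pow_zero, pow_succ]
    ring

/-- This inverts the memory sum, so that `expSum q v n * v n` becomes a quadratic expression in the
values of `expSum` alone. -/
lemma eq_expSum_add_sum (q : ℝ) (v : ℕ → ℝ) (h0 : v 0 = 0) (n : ℕ) :
    v (n + 1) = expSum q v (n + 1) + (1 - q) * ∑ k ∈ Finset.range (n + 1), expSum q v k := by
  induction n with
  | zero => simp [expSum, h0]
  | succ n ih =>
    rw [Finset.sum_range_succ, expSum_succ q v (n + 1)]
    linarith

/-- The memory term is a positive form: the discrete Caputo-Fabrizio derivative is dissipative. -/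
lemma sum_expSum_mul_nonneg {q : ℝ} (hq : -1 ≤ q) (hq' : q ≤ 1) (v : ℕ → ℝ) (h0 : v 0 = 0)
    (N : ℕ) : 0 ≤ ∑ n ∈ Finset.Icc 1 N, expSum q v n * v n := by
  -- With `E` the memory sum and `S` its partial sums, the new term is `E² + (1-q) E S`. It exceeds
  -- the growth `(1-q)/2 · ((S+E)² - S²)` of the left side by exactly `(1+q)/2 · E²`.
  have key : (1 - q) / 2 * (∑ k ∈ Finset.range (N + 1), expSum q v k) ^ 2
      ≤ ∑ n ∈ Finset.Icc 1 N, expSum q v n * v n := by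
    induction N with
    | zero => simp [expSum]
    | succ N ih =>
      rw [Finset.sum_Icc_succ_top (by omega), Finset.sum_range_succ]
      nth_rewrite 1 [eq_expSum_add_sum q v h0 N]
      nlinarith [mul_nonneg (by linarith : 0 ≤ 1 + q) (sq_nonneg (expSum q v (N + 1)))]
  exact le_trans (mul_nonneg (by linarith) (sq_nonneg _)) key

/-! ### Error equation, coercivity and the a priori estimate. -/

lemma exp_eq_pow (s τ : ℝ) {n k : ℕ} (h : k ≤ n) :
    Real.exp (-s * ((n : ℝ) - k) * τ) = Real.exp (-s * τ) ^ (n - k) := by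
  rw [← Real.exp_nat_mul, Nat.cast_sub h]
  congr 1
  ring

lemma discCF_eq (γ τ : ℝ) (v : ℕ → ℝ) (n : ℕ) :
    discCF γ τ v n = 1 / ((1 - γ) * sigma γ * τ) * (1 - Real.exp (-sigma γ * τ))
      * expSum (Real.exp (-sigma γ * τ)) v n := by
  unfold discCF expSum
  rw [Finset.mul_sum, Finset.mul_sum]
  refine Finset.sum_congr rfl fun k hk => ?_
  rw [exp_eq_pow _ _ (Finset.mem_Icc.1 hk).2, mul_assoc (1 - γ), one_div, one_div, mul_inv]
  ring

/-- By `expSum_succ_eq`, the history sum and the initial-value term of the scheme are `discCF`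
summed by parts. -/
lemma IsSchemeSolution.discCF_sub {α γ xR τ : ℝ} {f : ℝ → ℝ → ℝ} {u₀ : ℝ → ℝ} {Nx N : ℕ}
    {U : ℕ → ℕ → ℝ} (hU : IsSchemeSolution α γ xR f u₀ τ Nx N U) {n i : ℕ}
    (hn : n ∈ Finset.Icc 1 N) (hi : i ∈ Finset.Ico 1 Nx) :
    discCF γ τ (fun k => U k i) n - discRiesz α (xR / Nx) Nx (U n) i
      - f (i * (xR / Nx)) (n * τ) = 0 := by
  have h := hU.equation n hn i hi
  obtain ⟨n, rfl⟩ : ∃ m, n = m + 1 := ⟨n - 1, by have := (Finset.mem_Icc.1 hn).1; omega⟩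
  have e1 : ∀ k : ℕ, ((n + 1 : ℕ) : ℝ) - 1 - k = (n : ℝ) - k := fun k => by push_cast; ring
  have e2 : Real.exp (-sigma γ * (((n + 1 : ℕ) : ℝ) - 1) * τ) = Real.exp (-sigma γ * τ) ^ n := by
    have := exp_eq_pow (sigma γ) τ (Nat.zero_le n)
    push_cast at this ⊢
    simpa using this
  rw [discCF_eq, expSum_succ_eq]
  rw [e2] at h
  have e3 : ∑ k ∈ Finset.Ico 1 (n + 1), U k i
        * Real.exp (-sigma γ * (((n + 1 : ℕ) : ℝ) - 1 - k) * τ)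
        * (1 - Real.exp (-sigma γ * τ)) ^ 2
      = (1 - Real.exp (-sigma γ * τ)) ^ 2
        * ∑ k ∈ Finset.Ico 1 (n + 1), U k i * Real.exp (-sigma γ * τ) ^ (n - k) := by
    rw [Finset.mul_sum]
    refine Finset.sum_congr rfl fun k hk => ?_
    rw [e1, exp_eq_pow _ _ (by have := (Finset.mem_Ico.1 hk).2; omega)]
    ring
  rw [e3] at h
  linear_combination h

lemma discRiesz_sub (α h : ℝ) (Nx : ℕ) (v w : ℕ → ℝ) (i : ℕ) :
    discRiesz α h Nx (fun m => v m - w m) i = discRiesz α h Nx v i - discRiesz α h Nx w i := by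
  unfold discRiesz
  simp_rw [mul_sub, Finset.sum_sub_distrib]
  ring

lemma kappa_pos {α : ℝ} (hα : 1 < α) (hα' : α < 2) : 0 < kappa α := by
  have : Real.cos (α * Real.pi / 2) < 0 :=
    Real.cos_neg_of_pi_div_two_lt_of_lt (by nlinarith [Real.pi_pos]) (by nlinarith [Real.pi_pos])
  exact div_pos_of_neg_of_neg (by norm_num) (by linarith)

lemma sigma_pos {γ : ℝ} (h : 0 < γ) (h' : γ < 1) : 0 < sigma γ := div_pos h (by linarith)

/-- Three uses of the functional equation, with `Γ(1-α) < 0`; this converts the row sum constant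
into the `|Γ(1-α)|` of the error bound. -/
lemma abs_Gamma_one_sub_mul {α : ℝ} (hα : 1 < α) (hα' : α < 2) :
    |Real.Gamma (1 - α)| * ((3 - α) * (2 - α) * (α - 1)) = Real.Gamma (4 - α) := by
  have h2 := Real.Gamma_add_one (s := 1 - α) (by linarith)
  have h3 := Real.Gamma_add_one (s := 2 - α) (by linarith)
  have h4 := Real.Gamma_add_one (s := 3 - α) (by linarith)
  rw [show 1 - α + 1 = 2 - α by ring] at h2
  rw [show 2 - α + 1 = 3 - α by ring] at h3
  rw [show 3 - α + 1 = 4 - α by ring] at h4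
  have hpos : 0 < Real.Gamma (2 - α) := Real.Gamma_pos_of_pos (by linarith)
  have hneg : Real.Gamma (1 - α) < 0 := by
    by_contra! h
    nlinarith
  rw [abs_of_neg hneg, h4, h3, h2]
  ring

lemma one_le_Gamma_four_sub {α : ℝ} (hα' : α < 2) : 1 ≤ Real.Gamma (4 - α) := by
  rw [← Real.Gamma_two]
  exact Real.Gamma_strictMonoOn_Ici.monotoneOn (by simp) (by simp; linarith) (by linarith)

/-- Coercivity of the discrete Riesz operator on grid functions vanishing at both ends. -/
lemma sum_mul_discRiesz_le {α xR : ℝ} (hα : 1 < α) (hα' : α < 2) (hxR : 0 < xR) {N : ℕ}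
    (hN : 1 ≤ N) (v : ℕ → ℝ) (h0 : v 0 = 0) (h1 : v N = 0) :
    ∑ i ∈ Finset.Ico 1 N, v i * discRiesz α (xR / N) N v i
      ≤ -(2 * kappa α / (|Real.Gamma (1 - α)| * xR ^ α)) * ∑ i ∈ Finset.Ico 1 N, v i ^ 2 := by
  have hN0 : (0 : ℝ) < N := by exact_mod_cast hN
  have hs : ∀ i, ∑ m ∈ Finset.range (N + 1), g₂ α i m * v m
      = ∑ m ∈ Finset.Ico 1 N, g₂ α i m * v m := by
    intro i
    rw [Finset.sum_range_succ, h1, Finset.range_eq_Ico,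
      Finset.sum_eq_sum_Ico_succ_bot (by omega), h0]
    ring
  have hG4 : 0 < Real.Gamma (4 - α) := Real.Gamma_pos_of_pos (by linarith)
  have hc0 : 0 < (3 - α) * (2 - α) * (α - 1) := by
    apply mul_pos _ (by linarith)
    apply mul_pos <;> linarith
  have hG1 : 0 < |Real.Gamma (1 - α)| := by
    have := abs_Gamma_one_sub_mul hα hα'
    by_contra! h
    nlinarith
  have hA : 0 ≤ kappa α / (Real.Gamma (4 - α) * (xR / N) ^ α) :=
    div_nonneg (kappa_pos hα hα').le (by positivity)
  have h := mul_le_mul_of_nonneg_left (sum_g₂_mul_mul_le hα hα' N v) hA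
  have hx := Real.rpow_pos_of_pos hxR α
  have hn := Real.rpow_pos_of_pos hN0 α
  calc _ = kappa α / (Real.Gamma (4 - α) * (xR / N) ^ α)
        * ∑ i ∈ Finset.Ico 1 N, v i * ∑ m ∈ Finset.Ico 1 N, g₂ α i m * v m := by
        rw [Finset.mul_sum]
        refine Finset.sum_congr rfl fun i _ => ?_
        rw [discRiesz, hs]
        ring
    _ ≤ _ := h
    _ = _ := by
        rw [← mul_assoc]
        congr 1
        rw [← abs_Gamma_one_sub_mul hα hα', Real.div_rpow hxR.le hN0.le, Real.rpow_neg hN0.le]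
        have : 3 - α ≠ 0 := by linarith
        have : 2 - α ≠ 0 := by linarith
        have : α - 1 ≠ 0 := by linarith
        field_simp

/-- The a priori `ℓ²` estimate for the error equation. -/
lemma sum_sq_le {α γ xR τ : ℝ} (hα : 1 < α) (hα' : α < 2) (hγ : 0 < γ) (hγ' : γ < 1)
    (hxR : 0 < xR) (hτ : 0 < τ) {Nx N : ℕ} (hNx : 1 ≤ Nx) (e : ℕ → ℕ → ℝ) {δ c : ℝ}
    (hc : 0 < c) (hc' : c ≤ 2 * kappa α / (|Real.Gamma (1 - α)| * xR ^ α))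
    (hb : ∀ n ∈ Finset.Icc 1 N, e n 0 = 0 ∧ e n Nx = 0) (hi : ∀ i ∈ Finset.Ico 1 Nx, e 0 i = 0)
    (hδ : ∀ n ∈ Finset.Icc 1 N, ∀ i ∈ Finset.Ico 1 Nx,
      |discCF γ τ (fun k => e k i) n - discRiesz α (xR / Nx) Nx (e n) i| ≤ δ) :
    ∑ n ∈ Finset.Icc 1 N, ∑ i ∈ Finset.Ico 1 Nx, e n i ^ 2 ≤ N * Nx * δ ^ 2 / c ^ 2 := by
  have h1 : 0 ≤ ∑ n ∈ Finset.Icc 1 N, ∑ i ∈ Finset.Ico 1 Nx,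
      e n i * discCF γ τ (fun k => e k i) n := by
    -- Dissipativity holds only after summation in time, separately at each grid point.
    rw [Finset.sum_comm]
    refine Finset.sum_nonneg fun i hi' => ?_
    have hσ := sigma_pos hγ hγ'
    have hq : Real.exp (-sigma γ * τ) ≤ 1 := Real.exp_le_one_iff.2 (by nlinarith)
    have := sum_expSum_mul_nonneg (by linarith [Real.exp_pos (-sigma γ * τ)]) hq
      (fun k => e k i) (hi i hi') N
    have hA : 0 ≤ 1 / ((1 - γ) * sigma γ * τ) * (1 - Real.exp (-sigma γ * τ)) := by
      have : 0 < 1 - γ := by linarith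
      exact mul_nonneg (by positivity) (by linarith)
    refine (mul_nonneg hA this).trans_eq ?_
    rw [Finset.mul_sum]
    exact Finset.sum_congr rfl fun n _ => by rw [discCF_eq]; ring
  have h2 : ∀ n ∈ Finset.Icc 1 N, ∑ i ∈ Finset.Ico 1 Nx, e n i * discRiesz α (xR / Nx) Nx (e n) i
      ≤ -c * ∑ i ∈ Finset.Ico 1 Nx, e n i ^ 2 := by
    intro n hn
    refine (sum_mul_discRiesz_le hα hα' hxR hNx (e n) (hb n hn).1 (hb n hn).2).trans ?_
    exact mul_le_mul_of_nonneg_right (by linarith) (Finset.sum_nonneg fun _ _ => sq_nonneg _)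
  -- Young's inequality `e r ≤ c/2 · e² + r²/(2c)`: half of the coercivity absorbs the error, the
  -- other half remains.
  have h3 : ∀ n ∈ Finset.Icc 1 N, ∀ i ∈ Finset.Ico 1 Nx,
      e n i * discCF γ τ (fun k => e k i) n
        ≤ e n i * discRiesz α (xR / Nx) Nx (e n) i + (c / 2 * e n i ^ 2 + δ ^ 2 / (2 * c)) := by
    intro n hn i hi'
    set r := discCF γ τ (fun k => e k i) n - discRiesz α (xR / Nx) Nx (e n) i with hr
    have hr2 : r ^ 2 ≤ δ ^ 2 := sq_le_sq' (by linarith [abs_le.1 (hδ n hn i hi')])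
      (abs_le.1 (hδ n hn i hi')).2
    have : c / 2 * e n i ^ 2 + δ ^ 2 / (2 * c) - e n i * r
        = (c * e n i - r) ^ 2 / (2 * c) + (δ ^ 2 - r ^ 2) / (2 * c) := by
      field_simp
      ring
    have h4 : 0 ≤ (c * e n i - r) ^ 2 / (2 * c) + (δ ^ 2 - r ^ 2) / (2 * c) :=
      add_nonneg (by positivity) (div_nonneg (by linarith) (by linarith))
    have : e n i * r = e n i * discCF γ τ (fun k => e k i) n
        - e n i * discRiesz α (xR / Nx) Nx (e n) i := by rw [hr]; ring
    linarith
  have h4 : 0 ≤ ∑ n ∈ Finset.Icc 1 N, (-(c / 2) * ∑ i ∈ Finset.Ico 1 Nx, e n i ^ 2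
      + Nx * (δ ^ 2 / (2 * c))) := by
    refine h1.trans (Finset.sum_le_sum fun n hn => ?_)
    refine (Finset.sum_le_sum (h3 n hn)).trans ?_
    rw [Finset.sum_add_distrib, Finset.sum_add_distrib, ← Finset.mul_sum, Finset.sum_const,
      nsmul_eq_mul, Nat.card_Ico]
    have : ((Nx - 1 : ℕ) : ℝ) * (δ ^ 2 / (2 * c)) ≤ Nx * (δ ^ 2 / (2 * c)) :=
      mul_le_mul_of_nonneg_right (by exact_mod_cast Nat.sub_le _ _) (by positivity)
    linarith [h2 n hn]
  rw [Finset.sum_add_distrib, ← Finset.mul_sum, Finset.sum_const, nsmul_eq_mul, Nat.card_Icc,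
    Nat.add_sub_cancel] at h4
  rw [le_div_iff₀ (by positivity)]
  have h5 : N * (Nx * (δ ^ 2 / (2 * c))) * (2 * c) = N * Nx * δ ^ 2 := by
    field_simp
  nlinarith [mul_nonneg h4 (by linarith : 0 ≤ 2 * c)]

theorem error_bound {α γ xR T : ℝ} (hα : 1 < α) (hα' : α < 2) (hγ : 0 < γ) (hγ' : γ < 1)
    (hxR : 0 < xR) {f : ℝ → ℝ → ℝ} {u₀ : ℝ → ℝ} {u : ℝ → ℝ → ℝ}
    (hu : IsSolution α γ xR T f u₀ u) {C τ : ℝ} (hC : 0 < C) {Nx N : ℕ} (hτ : 0 < τ)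
    (hNx : 1 ≤ Nx) (hT : N * τ ≤ T) (hr : TruncBound α γ xR f u C τ Nx N)
    {U : ℕ → ℕ → ℝ} (hU : IsSchemeSolution α γ xR f u₀ τ Nx N U) :
    τ * ∑ n ∈ Finset.Icc 1 N,
        gridNorm (xR / Nx) Nx (fun i => u (i * (xR / Nx)) (n * τ) - U n i)
      ≤ |Real.Gamma (1 - α)| * Real.Gamma (4 - α) * xR ^ (α + 1 / 2) * T
          / (√2 * kappa α) * C * (τ ^ 2 + (xR / Nx) ^ 2) := by
  have hNx0 : (0 : ℝ) < Nx := by exact_mod_cast hNx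
  have hκ := kappa_pos hα hα'
  have hG4 := one_le_Gamma_four_sub hα'
  have hG1 : 0 < |Real.Gamma (1 - α)| := by
    have hc0 : 0 < (3 - α) * (2 - α) * (α - 1) := by
      apply mul_pos _ (by linarith)
      apply mul_pos <;> linarith
    have := abs_Gamma_one_sub_mul hα hα'
    by_contra! h
    nlinarith
  have hx := Real.rpow_pos_of_pos hxR α
  set e : ℕ → ℕ → ℝ := fun n i => u (i * (xR / Nx)) (n * τ) - U n i with he
  set δ : ℝ := C * (τ ^ 2 + (xR / Nx) ^ 2) with hδ
  have hδ0 : 0 < δ := by positivity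
  set c : ℝ := √2 * kappa α / (|Real.Gamma (1 - α)| * Real.Gamma (4 - α) * xR ^ α) with hc
  have hc0 : 0 < c := by positivity
  -- The constant of the theorem corresponds to less than the full coercivity, since `√2 ≤ 2` and `1
  -- ≤ Γ(4-α)`.
  have hcle : c ≤ 2 * kappa α / (|Real.Gamma (1 - α)| * xR ^ α) := by
    rw [hc]
    gcongr
    · rw [Real.sqrt_le_iff]; norm_num
    · exact le_mul_of_one_le_right hG1.le hG4
  have hb : ∀ n ∈ Finset.Icc 1 N, e n 0 = 0 ∧ e n Nx = 0 := by
    intro n hn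
    have hnN := (Finset.mem_Icc.1 hn).2
    have hnN' : (n : ℝ) ≤ N := by exact_mod_cast hnN
    have := hu.boundary (n * τ) ⟨by positivity, by nlinarith⟩
    have hU' := hU.boundary n hnN
    simp only [he]
    rw [hU'.1, hU'.2, mul_div_cancel₀ _ hNx0.ne', this.2]
    simp [this.1]
  have hi : ∀ i ∈ Finset.Ico 1 Nx, e 0 i = 0 := by
    intro i hi
    have hi' := Finset.mem_Ico.1 hi
    have h1 : (0 : ℝ) < i := by exact_mod_cast hi'.1
    have h2 : (i : ℝ) < Nx := by exact_mod_cast hi'.2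
    have := hu.initial (i * (xR / Nx)) ⟨by positivity, by
      rw [← mul_div_assoc, div_lt_iff₀ hNx0]; nlinarith⟩
    simp [he, hU.initial i hi, this]
  have hS := sum_sq_le hα hα' hγ hγ' hxR hτ (N := N) hNx e hc0 hcle hb hi (δ := δ) (by
    intro n hn i hi
    refine le_trans (le_of_eq ?_) (hr n hn i hi)
    congr 1
    have h0 := hU.discCF_sub hn hi
    have h1 : discCF γ τ (fun k => e k i) n = discCF γ τ (fun k => u (i * (xR / Nx)) (k * τ)) n
        - discCF γ τ (fun k => U k i) n := by
      rw [discCF_eq, discCF_eq, discCF_eq, he, expSum_sub]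
      ring
    rw [h1, he, discRiesz_sub, truncErr]
    linear_combination -h0)
  have hnorm : ∀ n ∈ Finset.Icc 1 N, gridNorm (xR / Nx) Nx (e n) ^ 2
      = xR / Nx * ∑ i ∈ Finset.Ico 1 Nx, e n i ^ 2 := by
    intro n hn
    rw [gridNorm, gridInner, Real.sq_sqrt (mul_nonneg (by positivity)
      (Finset.sum_nonneg fun _ _ => mul_self_nonneg _)), Finset.range_eq_Ico,
      Finset.sum_eq_sum_Ico_succ_bot (by omega), (hb n hn).1]
    simp [sq]
  -- Cauchy-Schwarz in time; the factor `√xR` comes from `Δx · Nx = xR`.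
  have hsq : (∑ n ∈ Finset.Icc 1 N, gridNorm (xR / Nx) Nx (e n)) ^ 2
      ≤ (N * √xR * δ / c) ^ 2 := by
    clear_value c δ
    refine (sq_sum_le_card_mul_sum_sq).trans ?_
    rw [Finset.sum_congr rfl hnorm, ← Finset.mul_sum, Nat.card_Icc, Nat.add_sub_cancel]
    calc (N : ℝ) * (xR / Nx * ∑ n ∈ Finset.Icc 1 N, ∑ i ∈ Finset.Ico 1 Nx, e n i ^ 2)
        ≤ N * (xR / Nx * (N * Nx * δ ^ 2 / c ^ 2)) := by gcongr
      _ = _ := by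
        rw [div_pow, mul_pow, mul_pow, Real.sq_sqrt hxR.le]
        field_simp
  have hsum := abs_le_of_sq_le_sq hsq (by positivity)
  calc τ * ∑ n ∈ Finset.Icc 1 N, gridNorm (xR / Nx) Nx (e n)
      ≤ τ * (N * √xR * δ / c) := by gcongr; exact (le_abs_self _).trans hsum
    _ = (N * τ) * (√xR * δ / c) := by ring
    _ ≤ T * (√xR * δ / c) := by gcongr
    _ = _ := by
      rw [hc, hδ, Real.rpow_add hxR, ← Real.sqrt_eq_rpow]
      field_simp

/-! ### Consistency in time. -/

/-- Replacing one factor of a product by its mean over an interval. -/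
lemma abs_integral_mul_sub_le {d E : ℝ → ℝ} {a b m A B : ℝ} (hab : a ≤ b)
    (hd : ContinuousOn d (Set.Icc a b)) (hE : ContinuousOn E (Set.Icc a b))
    (hm : ∫ s in a..b, d s = m * (b - a)) (hA : ∀ s ∈ Set.Icc a b, |d s - m| ≤ A)
    (hB : ∀ s ∈ Set.Icc a b, |E s - E b| ≤ B) :
    |(∫ s in a..b, d s * E s) - m * ∫ s in a..b, E s| ≤ A * B * (b - a) := by
  rw [← Set.uIcc_of_le hab] at hd hE
  have i1 : IntervalIntegrable (fun s => d s * E s) MeasureTheory.volume a b :=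
    (hd.mul hE).intervalIntegrable
  have i2 : IntervalIntegrable E MeasureTheory.volume a b := hE.intervalIntegrable
  have i3 : IntervalIntegrable d MeasureTheory.volume a b := hd.intervalIntegrable
  -- Since `d - m` has integral zero, the constant `E b` can be subtracted from `E` for free; both
  -- factors are then small, which gains one order.
  have e : (∫ s in a..b, d s * E s) - m * ∫ s in a..b, E s
      = ∫ s in a..b, (d s - m) * (E s - E b) := by
    have : ∀ s, (d s - m) * (E s - E b) = (d s * E s - m * E s) - (d s * E b - m * E b) :=
      fun s => by ring
    simp_rw [this]
    rw [intervalIntegral.integral_sub (i1.sub (i2.const_mul m))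
      ((i3.mul_const _).sub intervalIntegrable_const), intervalIntegral.integral_sub i1
      (i2.const_mul m), intervalIntegral.integral_sub (i3.mul_const _) intervalIntegrable_const,
      intervalIntegral.integral_const_mul, intervalIntegral.integral_mul_const, hm,
      intervalIntegral.integral_const]
    simp only [smul_eq_mul]
    ring
  rw [e, ← Real.norm_eq_abs]
  have := intervalIntegral.norm_integral_le_of_norm_le_const (a := a) (b := b) (C := A * B)
    (f := fun s => (d s - m) * (E s - E b)) (fun s hs => by
      rw [Set.uIoc_of_le hab] at hs
      have hs' := Set.Ioc_subset_Icc_self hs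
      rw [norm_mul]
      exact mul_le_mul (hA s hs') (hB s hs') (norm_nonneg _) ((abs_nonneg _).trans (hA s hs')))
  rwa [abs_of_nonneg (sub_nonneg.2 hab)] at this

lemma integral_exp_memory {σ : ℝ} (hσ : σ ≠ 0) (t a b : ℝ) :
    ∫ s in a..b, Real.exp (-σ * (t - s))
      = Real.exp (-σ * (t - b)) * (1 - Real.exp (-σ * (b - a))) / σ := by
  have hd : ∀ s ∈ Set.uIcc a b, HasDerivAt (fun s => Real.exp (-σ * (t - s)) / σ)
      (Real.exp (-σ * (t - s))) s := by
    intro s _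
    have h := ((((hasDerivAt_id s).const_sub t).const_mul (-σ)).exp).div_const σ
    refine h.congr_deriv ?_
    simp only [id]
    field_simp
  rw [intervalIntegral.integral_eq_sub_of_hasDerivAt hd
    (Continuous.intervalIntegrable (by fun_prop) _ _), mul_one_sub, ← Real.exp_add]
  rw [show -σ * (t - b) + -σ * (b - a) = -σ * (t - a) by ring]
  ring

lemma abs_exp_memory_sub_le {σ t s b : ℝ} (hσ : 0 ≤ σ) (hsb : s ≤ b) (hbt : b ≤ t) :
    |Real.exp (-σ * (t - s)) - Real.exp (-σ * (t - b))| ≤ σ * (b - s) := by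
  have h1 : Real.exp (-σ * (t - s)) = Real.exp (-σ * (t - b)) * Real.exp (-σ * (b - s)) := by
    rw [← Real.exp_add]
    congr 1
    ring
  have h2 : Real.exp (-σ * (t - b)) ≤ 1 := Real.exp_le_one_iff.2 (by nlinarith)
  have h3 := Real.add_one_le_exp (-σ * (b - s))
  have h4 : Real.exp (-σ * (b - s)) ≤ 1 := Real.exp_le_one_iff.2 (by nlinarith)
  have h5 := Real.exp_pos (-σ * (t - b))
  rw [h1, abs_le]
  constructor <;> nlinarith

lemma hasDerivAt_of_contDiffOn {v : ℝ → ℝ} {T s : ℝ} (hv : ContDiffOn ℝ 1 v (Set.Icc 0 T))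
    (hs : s ∈ Set.Ioo 0 T) : HasDerivAt v (derivWithin v (Set.Icc 0 T) s) s :=
  ((hv.differentiableOn one_ne_zero s (Set.Ioo_subset_Icc_self hs)).hasDerivWithinAt).hasDerivAt
    (Icc_mem_nhds hs.1 hs.2)

/-- Consistency of the discrete Caputo-Fabrizio derivative. -/
theorem abs_discCF_sub_cfDeriv_le {γ T τ : ℝ} (hγ : 0 < γ) (hγ' : γ < 1) (hτ : 0 < τ)
    {v : ℝ → ℝ} {K : NNReal} (hv : ContDiffOn ℝ 1 v (Set.Icc 0 T))
    (hK : LipschitzOnWith K (derivWithin v (Set.Icc 0 T)) (Set.Icc 0 T)) {n : ℕ} (hn : 1 ≤ n)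
    (hT : n * τ ≤ T) :
    |discCF γ τ (fun k => v (k * τ)) n - cfDeriv γ v (n * τ)|
      ≤ 1 / (1 - γ) * (K * sigma γ * T) * τ ^ 2 := by
  have hσ := sigma_pos hγ hγ'
  set σ := sigma γ
  set d := derivWithin v (Set.Icc 0 T)
  set t : ℝ := n * τ
  have hn0 : (0 : ℝ) < n := by exact_mod_cast hn
  have ht : 0 < t := mul_pos hn0 hτ
  have hcd : ContinuousOn d (Set.Icc 0 T) := hK.continuousOn
  have hEc : Continuous fun s => Real.exp (-σ * (t - s)) := by fun_prop
  have hsub : ∀ k < n, Set.Icc ((k : ℝ) * τ) ((k + 1 : ℕ) * τ) ⊆ Set.Icc 0 T := by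
    intro k hk
    have : ((k + 1 : ℕ) : ℝ) ≤ n := by exact_mod_cast hk
    exact Set.Icc_subset_Icc (by positivity) ((mul_le_mul_of_nonneg_right this hτ.le).trans hT)
  have hcf : ∫ s in (0 : ℝ)..t, deriv v s * Real.exp (-σ * (t - s))
      = ∑ k ∈ Finset.range n, ∫ s in ((k : ℝ) * τ)..((k + 1 : ℕ) * τ),
        d s * Real.exp (-σ * (t - s)) := by
    rw [intervalIntegral.sum_integral_adjacent_intervals (a := fun k : ℕ => (k : ℝ) * τ)
      (fun k hk => ?_)]
    · simp only [Nat.cast_zero, zero_mul]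
      refine intervalIntegral.integral_congr_ae ?_
      -- On `(0, t]` the derivative and the one-sided `derivWithin` can differ only at `s = T`.
      have : ∀ᵐ s : ℝ, s ≠ T := by simp [MeasureTheory.ae_iff, MeasureTheory.measure_singleton]
      filter_upwards [this] with s hsT hs
      rw [Set.uIoc_of_le ht.le] at hs
      rw [(hasDerivAt_of_contDiffOn hv ⟨hs.1, lt_of_le_of_ne (hs.2.trans hT) hsT⟩).deriv]
    · apply ContinuousOn.intervalIntegrable
      rw [Set.uIcc_of_le (by push_cast; nlinarith)]
      exact (hcd.mono (hsub k hk)).mul hEc.continuousOn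
  have hstep : ∀ k ∈ Finset.range n,
      |(∫ s in ((k : ℝ) * τ)..((k + 1 : ℕ) * τ), d s * Real.exp (-σ * (t - s)))
        - (v ((k + 1 : ℕ) * τ) - v (k * τ)) / (σ * τ) * Real.exp (-σ * ((n : ℝ) - (k + 1 : ℕ)) * τ)
          * (1 - Real.exp (-σ * τ))| ≤ K * σ * τ ^ 3 := by
    intro k hk
    have hk := Finset.mem_range.1 hk
    have hab' : ((k + 1 : ℕ) : ℝ) * τ - k * τ = τ := by push_cast; ring
    have hsubk := hsub k hk
    set a : ℝ := k * τ
    set b : ℝ := (k + 1 : ℕ) * τ with hb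
    have hab : a < b := by linarith
    have hbt : b ≤ t := by
      have : ((k + 1 : ℕ) : ℝ) ≤ n := by exact_mod_cast hk
      exact mul_le_mul_of_nonneg_right this hτ.le
    have ha0 : 0 ≤ a := by positivity
    have hder : ∀ s ∈ Set.Ioo a b, HasDerivAt v (d s) s := fun s hs =>
      hasDerivAt_of_contDiffOn hv ⟨ha0.trans_lt hs.1, hs.2.trans_le (hbt.trans hT)⟩
    have hvc : ContinuousOn v (Set.Icc a b) := hv.continuousOn.mono hsubk
    -- The mean of `d` over the cell is a value `d ξ`, so the Lipschitz bound controls the deviation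
    -- of `d` from its mean by `K τ`.
    obtain ⟨ξ, hξ, hs⟩ := exists_hasDerivAt_eq_slope v d hab hvc hder
    have hdc := hcd.mono hsubk
    have hint : ∫ s in a..b, d s = (v b - v a) / τ * (b - a) := by
      rw [intervalIntegral.integral_eq_sub_of_hasDerivAt_of_le hab.le hvc hder
        (ContinuousOn.intervalIntegrable (by rwa [Set.uIcc_of_le hab.le])), hab']
      field_simp
    have hsl : (v b - v a) / τ = d ξ := by rw [hs, hab']
    have key := abs_integral_mul_sub_le (A := K * τ) (B := σ * τ) hab.le hdc hEc.continuousOn hint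
      (fun s hs => by
        rw [hsl, ← Real.dist_eq]
        refine (hK.dist_le_mul s (hsubk hs) ξ (hsubk (Set.Ioo_subset_Icc_self hξ))).trans ?_
        gcongr
        rw [Real.dist_eq, abs_le]
        constructor <;> linarith [hs.1, hs.2, hξ.1, hξ.2])
      (fun s hs => (abs_exp_memory_sub_le hσ.le hs.2 hbt).trans
        (mul_le_mul_of_nonneg_left (by linarith [hs.1]) hσ.le))
    rw [integral_exp_memory hσ.ne', hab'] at key
    have e1 : -σ * (t - b) = -σ * ((n : ℝ) - (k + 1 : ℕ)) * τ := by rw [hb]; ring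
    rw [e1] at key
    refine le_trans (le_of_eq ?_) (key.trans (le_of_eq (by ring)))
    congr 2
    field_simp
  have hdisc : discCF γ τ (fun k => v (k * τ)) n = 1 / (1 - γ) * ∑ k ∈ Finset.range n,
      (v ((k + 1 : ℕ) * τ) - v (k * τ)) / (σ * τ) * Real.exp (-σ * ((n : ℝ) - (k + 1 : ℕ)) * τ)
        * (1 - Real.exp (-σ * τ)) := by
    unfold discCF
    have := Finset.sum_Ico_add' (fun k : ℕ => (v (k * τ) - v ((k - 1 : ℕ) * τ))
      / (σ * τ) * Real.exp (-σ * ((n : ℝ) - k) * τ) * (1 - Real.exp (-σ * τ))) 0 n 1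
    rw [zero_add, Finset.Ico_add_one_right_eq_Icc, ← Finset.range_eq_Ico] at this
    rw [← this]
    rfl
  rw [hdisc, cfDeriv, hcf, ← mul_sub, ← Finset.sum_sub_distrib, abs_mul,
    abs_of_pos (div_pos one_pos (by linarith : 0 < 1 - γ)), mul_assoc (1 / (1 - γ))]
  refine mul_le_mul_of_nonneg_left ?_ (div_pos one_pos (by linarith : 0 < 1 - γ)).le
  refine (Finset.abs_sum_le_sum_abs _ _).trans ?_
  refine (Finset.sum_le_sum fun k hk => (abs_sub_comm _ _).trans_le (hstep k hk)).trans ?_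
  rw [Finset.sum_const, Finset.card_range, nsmul_eq_mul]
  calc (n : ℝ) * (K * σ * τ ^ 3) = K * σ * τ ^ 2 * (n * τ) := by ring
    _ ≤ K * σ * τ ^ 2 * T := by gcongr
    _ = _ := by ring

/-! ### The Riesz derivative as a weakly singular integral. -/

lemma intervalIntegrable_kernel_mul {α a b : ℝ} (hα' : α < 2) {φ : ℝ → ℝ} (hφ : Continuous φ) :
    IntervalIntegrable (fun y => y ^ (1 - α) * φ y) MeasureTheory.volume a b :=
  (intervalIntegral.intervalIntegrable_rpow' (by linarith)).mul_continuousOn hφ.continuousOn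

/-- Differentiation of the weakly singular integral `∫_0^R y^{1-α} φ(x + s y) dy` in `x`. -/
lemma hasDerivAt_integral_kernel {α R s M : ℝ} (hα' : α < 2) {φ φ' : ℝ → ℝ}
    (hd : ∀ x, HasDerivAt φ (φ' x) x) (hc : Continuous φ') (hM : ∀ x, |φ' x| ≤ M) (x : ℝ) :
    HasDerivAt (fun x => ∫ y in (0 : ℝ)..R, y ^ (1 - α) * φ (x + s * y))
      (∫ y in (0 : ℝ)..R, y ^ (1 - α) * φ' (x + s * y)) x := by
  have hcφ : Continuous φ := continuous_iff_continuousAt.2 fun x => (hd x).continuousAt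
  have hi : ∀ z, IntervalIntegrable (fun y => y ^ (1 - α) * φ (z + s * y))
      MeasureTheory.volume 0 R := fun z => intervalIntegrable_kernel_mul hα' (by fun_prop)
  have hi' : IntervalIntegrable (fun y => y ^ (1 - α) * φ' (x + s * y))
      MeasureTheory.volume 0 R := intervalIntegrable_kernel_mul hα' (by fun_prop)
  refine (intervalIntegral.hasDerivAt_integral_of_dominated_loc_of_deriv_le
    (F' := fun z y => y ^ (1 - α) * φ' (z + s * y)) (bound := fun y => ‖y ^ (1 - α)‖ * M)
    Filter.univ_mem (Filter.Eventually.of_forall fun z => (intervalIntegrable_iff.1 (hi z)).aestronglyMeasurable) (hi x)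
    (intervalIntegrable_iff.1 hi').aestronglyMeasurable ?_ ?_ ?_).2
  · refine Filter.Eventually.of_forall fun y _ z _ => ?_
    rw [norm_mul]
    exact mul_le_mul_of_nonneg_left (hM _) (norm_nonneg _)
  · exact (intervalIntegral.intervalIntegrable_rpow' (by linarith)).norm.mul_const M
  · refine Filter.Eventually.of_forall fun y _ z _ => ?_
    have := (hd (z + s * y)).comp z ((hasDerivAt_id z).add_const (s * y))
    rw [mul_one] at this
    exact this.const_mul _

lemma iteratedDeriv_two_integral_kernel {α R s M : ℝ} (hα' : α < 2) {φ φ' φ'' : ℝ → ℝ}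
    (hd : ∀ x, HasDerivAt φ (φ' x) x) (hd' : ∀ x, HasDerivAt φ' (φ'' x) x) (hc : Continuous φ'')
    (hM : ∀ x, |φ' x| ≤ M) (hM' : ∀ x, |φ'' x| ≤ M) (x : ℝ) :
    iteratedDeriv 2 (fun x => ∫ y in (0 : ℝ)..R, y ^ (1 - α) * φ (x + s * y)) x
      = ∫ y in (0 : ℝ)..R, y ^ (1 - α) * φ'' (x + s * y) := by
  have hcφ : Continuous φ' := continuous_iff_continuousAt.2 fun x => (hd' x).continuousAt
  rw [iteratedDeriv_succ, iteratedDeriv_one]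
  have : deriv (fun x => ∫ y in (0 : ℝ)..R, y ^ (1 - α) * φ (x + s * y))
      = fun x => ∫ y in (0 : ℝ)..R, y ^ (1 - α) * φ' (x + s * y) :=
    funext fun z => (hasDerivAt_integral_kernel hα' hd hcφ hM z).deriv
  rw [this]
  exact (hasDerivAt_integral_kernel hα' hd' hc hM' x).deriv

lemma integral_eq_of_eq_zero {F : ℝ → ℝ} {a b c : ℝ} (hbc : b ≤ c)
    (hi : IntervalIntegrable F MeasureTheory.volume a b)
    (h0 : ∀ y ∈ Set.Ioc b c, F y = 0) : ∫ y in a..b, F y = ∫ y in a..c, F y := by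
  have e : ∀ᵐ y, y ∈ Set.uIoc b c → F y = 0 :=
    Filter.Eventually.of_forall fun y hy => h0 y (by rwa [Set.uIoc_of_le hbc] at hy)
  have hi' : IntervalIntegrable F MeasureTheory.volume b c := by
    refine (intervalIntegrable_const (c := (0 : ℝ))).congr fun y hy => ?_
    rw [Set.uIoc_of_le hbc] at hy
    exact (h0 y hy).symm
  rw [← intervalIntegral.integral_add_adjacent_intervals hi hi',
    intervalIntegral.integral_zero_ae e, add_zero]

/-- Substituting `y = x - ξ` and extending by zero makes the interval and the singular kernel
independent of `x`, so that differentiation in `x` falls on the smooth factor only. -/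
lemma leftInt_eq {α R x : ℝ} (hα' : α < 2) {v : ℝ → ℝ}
    (hw : Continuous ((Set.Icc 0 R).indicator v)) (hx : x ∈ Set.Ioo 0 R) :
    leftInt α v x
      = ∫ y in (0 : ℝ)..R, y ^ (1 - α) * (Set.Icc 0 R).indicator v (x + -1 * y) := by
  have h := intervalIntegral.integral_comp_sub_left
    (fun y => y ^ (1 - α) * (Set.Icc 0 R).indicator v (x + -1 * y)) x (a := 0) (b := x)
  rw [sub_self, sub_zero] at h
  rw [← integral_eq_of_eq_zero hx.2.le (intervalIntegrable_kernel_mul hα' (by fun_prop)), ← h,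
    leftInt]
  · refine intervalIntegral.integral_congr fun ξ hξ => ?_
    rw [Set.uIcc_of_le hx.1.le] at hξ
    have : x + -1 * (x - ξ) = ξ := by ring
    simp only [this]
    rw [Set.indicator_of_mem (show ξ ∈ Set.Icc 0 R from ⟨hξ.1, hξ.2.trans hx.2.le⟩)]
  · intro y hy
    rw [Set.indicator_of_notMem (fun hm => by linarith [hm.1, hy.1]), mul_zero]

lemma rightInt_eq {α R x : ℝ} (hα' : α < 2) {v : ℝ → ℝ}
    (hw : Continuous ((Set.Icc 0 R).indicator v)) (hx : x ∈ Set.Ioo 0 R) :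
    rightInt α R v x
      = ∫ y in (0 : ℝ)..R, y ^ (1 - α) * (Set.Icc 0 R).indicator v (x + 1 * y) := by
  have h := intervalIntegral.integral_comp_sub_right
    (fun y => y ^ (1 - α) * (Set.Icc 0 R).indicator v (x + 1 * y)) x (a := x) (b := R)
  rw [sub_self] at h
  rw [← integral_eq_of_eq_zero (b := R - x) (by linarith [hx.1])
    (intervalIntegrable_kernel_mul hα' (by fun_prop)), ← h, rightInt]
  · refine intervalIntegral.integral_congr fun ξ hξ => ?_
    rw [Set.uIcc_of_le hx.2.le] at hξ
    have : x + 1 * (ξ - x) = ξ := by ring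
    simp only [this]
    rw [Set.indicator_of_mem (show ξ ∈ Set.Icc 0 R from ⟨hx.1.le.trans hξ.1, hξ.2⟩)]
  · intro y hy
    rw [Set.indicator_of_notMem (fun hm => by linarith [hm.2, hy.1]), mul_zero]

/-- The Riesz derivative of a function with smooth extension by zero, as a weakly singular
integral of the second derivative. -/
theorem rieszDeriv_eq {α R x M : ℝ} (hα' : α < 2) {v w' w'' : ℝ → ℝ}
    (hd : ∀ x, HasDerivAt ((Set.Icc 0 R).indicator v) (w' x) x)
    (hd' : ∀ x, HasDerivAt w' (w'' x) x) (hc : Continuous w'')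
    (hM : ∀ x, |w' x| ≤ M) (hM' : ∀ x, |w'' x| ≤ M) (hx : x ∈ Set.Ioo 0 R) :
    rieszDeriv α R v x = kappa α / Real.Gamma (2 - α)
      * ∫ y in (0 : ℝ)..R, y ^ (1 - α) * (w'' (x - y) + w'' (x + y)) := by
  have hw : Continuous ((Set.Icc 0 R).indicator v) :=
    continuous_iff_continuousAt.2 fun x => (hd x).continuousAt
  have hnhds : Set.Ioo 0 R ∈ 𝓝 x := Ioo_mem_nhds hx.1 hx.2
  have hl : leftInt α v =ᶠ[𝓝 x] fun x => ∫ y in (0 : ℝ)..R,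
      y ^ (1 - α) * (Set.Icc 0 R).indicator v (x + -1 * y) := by
    filter_upwards [hnhds] with z hz using leftInt_eq hα' hw hz
  have hr : rightInt α R v =ᶠ[𝓝 x] fun x => ∫ y in (0 : ℝ)..R,
      y ^ (1 - α) * (Set.Icc 0 R).indicator v (x + 1 * y) := by
    filter_upwards [hnhds] with z hz using rightInt_eq hα' hw hz
  rw [rieszDeriv, leftRL, rightRL, hl.iteratedDeriv_eq, hr.iteratedDeriv_eq,
    iteratedDeriv_two_integral_kernel hα' hd hd' hc hM hM',
    iteratedDeriv_two_integral_kernel hα' hd hd' hc hM hM', ← mul_add,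
    ← intervalIntegral.integral_add (intervalIntegrable_kernel_mul hα' (by fun_prop))
      (intervalIntegrable_kernel_mul hα' (by fun_prop))]
  rw [← mul_assoc, mul_one_div]
  congr 1
  refine intervalIntegral.integral_congr fun y _ => ?_
  simp only [neg_mul, one_mul, ← sub_eq_add_neg]
  ring

/-! ### The scheme coefficients as quadrature weights. -/

/-- Second differences of `j ↦ |j|^β`. -/
def secondDiff (β : ℝ) : ℕ → ℝ
  | 0 => 2
  | j + 1 => ((j : ℝ) + 2) ^ β - 2 * ((j : ℝ) + 1) ^ β + (j : ℝ) ^ β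

/-- Because `secondDiff` refers to the even function `|j|^β`, with value `2` at `0`, the exceptional
neighbour coefficient `g_0 + g_2` follows the same rule as the others. -/
lemma offDiag_succ_eq {α : ℝ} (hα : α < 3) (n : ℕ) : offDiag α (n + 1)
    = secondDiff (3 - α) (n + 2) - 2 * secondDiff (3 - α) (n + 1) + secondDiff (3 - α) n := by
  rcases n with _ | n
  · have h0 : (0 : ℝ) ^ (3 - α) = 0 := Real.zero_rpow (by linarith)
    simp [offDiag, g, secondDiff, two_rpow_five_sub, h0]
    norm_num
    ring
  · rw [offDiag, if_neg (by omega), show n + 1 + 1 + 1 = n + 3 by rfl, g]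
    simp only [secondDiff]
    push_cast
    rw [show (n : ℝ) + 2 + 2 = n + 4 by ring, show (n : ℝ) + 2 + 1 = n + 3 by ring,
      show (n : ℝ) + 1 + 2 = n + 3 by ring, show (n : ℝ) + 1 + 1 = n + 2 by ring]
    ring

/-- Summation by parts: the quadrature of second differences `q` of an even sequence `p` in terms
of the coefficients of the scheme. -/
lemma sum_quadrature_eq {α : ℝ} (hα : α < 2) (p q : ℕ → ℝ) (h0 : q 0 = 2 * p 1 - 2 * p 0)
    (hq : ∀ j, q (j + 1) = p (j + 2) - 2 * p (j + 1) + p j) (n : ℕ) :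
    ∑ j ∈ Finset.range (n + 1),
      ((((j : ℝ) + 1) ^ (3 - α) - (j : ℝ) ^ (3 - α) - (3 - α) * (j : ℝ) ^ (2 - α)) * q j
      + ((j : ℝ) ^ (3 - α) - ((j : ℝ) + 1) ^ (3 - α) + (3 - α) * ((j : ℝ) + 1) ^ (2 - α))
        * q (j + 1))
    = g α 1 * p 0 + ∑ j ∈ Finset.Ico 1 (n + 1), offDiag α j * p j
      - secondDiff (3 - α) (n + 1) * p n + secondDiff (3 - α) n * p (n + 1)
      + ((n : ℝ) ^ (3 - α) - ((n : ℝ) + 1) ^ (3 - α) + (3 - α) * ((n : ℝ) + 1) ^ (2 - α))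
        * q (n + 1) := by
  -- The two cells meeting at node `j ≥ 1` give `q j` the total weight `secondDiff (3 - α) j`, as
  -- the `(2 - α)`-powers cancel. Moving the second difference from `p` to these weights creates the
  -- coefficients and the boundary terms.
  induction n with
  | zero =>
    have h1 : (0 : ℝ) ^ (3 - α) = 0 := Real.zero_rpow (by linarith)
    have h2 : (0 : ℝ) ^ (2 - α) = 0 := Real.zero_rpow (by linarith)
    simp [h1, h2, h0, secondDiff, g]
    ring
  | succ n ih =>
    rw [Finset.sum_range_succ, ih, Finset.sum_Ico_succ_top (by omega : 1 ≤ n + 1),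
      offDiag_succ_eq (by linarith), hq n]
    push_cast
    rw [show (n : ℝ) + 1 + 1 = n + 2 by ring]
    simp only [secondDiff]
    push_cast
    rw [show (n : ℝ) + 1 + 1 = n + 2 by ring]
    ring

/-- The row of the scheme at `i`, folded around the diagonal. -/
lemma sum_g₂_mul_eq (α : ℝ) {i N : ℕ} (hi : i ∈ Finset.Ico 1 N) (w : ℝ → ℝ)
    {h : ℝ} (hw : ∀ x, x ≤ 0 → w x = 0) (hw' : ∀ x, N * h ≤ x → w x = 0) (hh : 0 ≤ h) :
    ∑ m ∈ Finset.range (N + 1), g₂ α i m * w (m * h)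
      = g α 1 * (w (i * h) + w (i * h))
        + ∑ j ∈ Finset.Ico 1 N, offDiag α j * (w (i * h - j * h) + w (i * h + j * h)) := by
  rw [Finset.mem_Ico] at hi
  rw [Finset.range_eq_Ico, ← Finset.sum_Ico_consecutive _ (Nat.zero_le i) (by omega : i ≤ N + 1),
    Finset.sum_eq_sum_Ico_succ_bot (by omega : i < N + 1), g₂_self]
  have h1 : ∑ m ∈ Finset.Ico 0 i, g₂ α i m * w (m * h)
      = ∑ j ∈ Finset.Ico 1 N, offDiag α j * w (i * h - j * h) := by
    have e : ∀ m ∈ Finset.Ico 0 i, g₂ α i m * w (m * h)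
        = (fun j : ℕ => offDiag α j * w (i * h - j * h)) (i - m) := by
      intro m hm
      have hm := (Finset.mem_Ico.1 hm).2
      simp only
      rw [g₂_of_lt α hm, Nat.cast_sub hm.le]
      congr 2
      ring
    rw [Finset.sum_congr rfl e, Finset.sum_Ico_reflect
      (fun j : ℕ => offDiag α j * w (i * h - j * h)) 0 (by omega : i ≤ i + 1)]
    -- The added indices sample `w` at nonpositive points, where it vanishes.
    apply Finset.sum_subset
    · intro j
      simp only [Finset.mem_Ico]
      omega
    · intro j hj hj'
      simp only [Finset.mem_Ico] at hj hj'
      have : (i : ℝ) ≤ j := by exact_mod_cast (by omega : i ≤ j)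
      rw [hw _ (by nlinarith), mul_zero]
  have h2 : ∑ m ∈ Finset.Ico (i + 1) (N + 1), g₂ α i m * w (m * h)
      = ∑ j ∈ Finset.Ico 1 N, offDiag α j * w (i * h + j * h) := by
    have e : ∀ m ∈ Finset.Ico (i + 1) (N + 1), g₂ α i m * w (m * h)
        = (fun j : ℕ => offDiag α j * w (i * h + j * h)) (m - i) := by
      intro m hm
      have hm : i < m := (Finset.mem_Ico.1 hm).1
      simp only
      rw [g₂_of_gt α hm, Nat.cast_sub hm.le]
      congr 2
      ring
    rw [Finset.sum_congr rfl e]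
    have := Finset.sum_Ico_add' (fun m => (fun j : ℕ => offDiag α j * w (i * h + j * h)) (m - i))
      1 (N + 1 - i) i
    rw [Nat.add_comm 1 i, Nat.sub_add_cancel (by omega : i ≤ N + 1)] at this
    rw [← this]
    simp only [Nat.add_sub_cancel]
    apply Finset.sum_subset
    · intro j
      simp only [Finset.mem_Ico]
      omega
    · intro j hj hj'
      simp only [Finset.mem_Ico] at hj hj'
      have : (N : ℝ) ≤ i + j := by exact_mod_cast (by omega : N ≤ i + j)
      rw [hw' _ (by nlinarith), mul_zero]
  rw [h1, h2]
  simp_rw [mul_add, Finset.sum_add_distrib]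
  ring

/-- The exact integral of the kernel against a linear interpolant on one cell. -/
lemma integral_kernel_mul_linear {α h : ℝ} (hα : 1 < α) (hα' : α < 2) (hh : 0 < h) (j : ℕ)
    (a b : ℝ) :
    ∫ y in ((j : ℝ) * h)..((j + 1 : ℕ) * h),
        y ^ (1 - α) * (((j : ℝ) + 1 - y / h) * a + (y / h - j) * b)
      = h ^ (2 - α) / ((3 - α) * (2 - α))
        * ((((j : ℝ) + 1) ^ (3 - α) - (j : ℝ) ^ (3 - α) - (3 - α) * (j : ℝ) ^ (2 - α)) * a
          + ((j : ℝ) ^ (3 - α) - ((j : ℝ) + 1) ^ (3 - α) + (3 - α) * ((j : ℝ) + 1) ^ (2 - α))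
            * b) := by
  have hj : (0 : ℝ) ≤ j := by positivity
  have hj1 : (0 : ℝ) ≤ (j : ℝ) + 1 := by positivity
  have hle : (j : ℝ) * h ≤ ((j + 1 : ℕ) : ℝ) * h := by push_cast; nlinarith
  have e : ∀ y ∈ Set.uIcc ((j : ℝ) * h) (((j + 1 : ℕ) : ℝ) * h),
      y ^ (1 - α) * (((j : ℝ) + 1 - y / h) * a + (y / h - j) * b)
        = (((j : ℝ) + 1) * a - j * b) * y ^ (1 - α) + (b - a) / h * y ^ (2 - α) := by
    intro y hy
    rw [Set.uIcc_of_le hle] at hy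
    have hy0 : 0 ≤ y := le_trans (by positivity) hy.1
    rw [show 2 - α = 1 - α + 1 by ring, Real.rpow_add_one' hy0 (by linarith)]
    field_simp
    ring
  rw [intervalIntegral.integral_congr e, intervalIntegral.integral_add
    ((intervalIntegral.intervalIntegrable_rpow' (by linarith)).const_mul _)
    ((intervalIntegral.intervalIntegrable_rpow' (by linarith)).const_mul _),
    intervalIntegral.integral_const_mul, intervalIntegral.integral_const_mul,
    integral_rpow (Or.inl (by linarith)), integral_rpow (Or.inl (by linarith))]
  rw [show 1 - α + 1 = 2 - α by ring, show 2 - α + 1 = 3 - α by ring]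
  push_cast
  rw [Real.mul_rpow hj hh.le, Real.mul_rpow hj1 hh.le, Real.mul_rpow hj hh.le,
    Real.mul_rpow hj1 hh.le]
  have e3 : ∀ z : ℝ, 0 ≤ z → z ^ (3 - α) = z ^ (2 - α) * z := by
    intro z hz
    rw [show 3 - α = 2 - α + 1 by ring, Real.rpow_add_one' hz (by linarith)]
  rw [e3 h hh.le, e3 j hj, e3 _ hj1]
  have h2 : 2 - α ≠ 0 := by linarith
  have h3 : 3 - α ≠ 0 := by linarith
  field_simp
  ring

/-! ### Taylor bounds and accuracy of the quadrature. -/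

section Taylor

variable {V V' : ℝ → ℝ} {K : NNReal}

lemma abs_taylor_one_le (hd : ∀ x, HasDerivAt V (V' x) x) (hK : LipschitzWith K V') (a b : ℝ) :
    |V b - V a - V' a * (b - a)| ≤ K * (b - a) ^ 2 := by
  have hd' : ∀ x ∈ Set.uIcc a b, HasDerivWithinAt (fun x => V x - V' a * x) (V' x - V' a)
      (Set.uIcc a b) x := fun x _ => by
    exact (((hd x).sub ((hasDerivAt_id x).const_mul (V' a))).congr_deriv
      (by ring)).hasDerivWithinAt
  have := (convex_uIcc a b).norm_image_sub_le_of_norm_hasDerivWithin_le (C := K * |b - a|) hd'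
    (fun x hx => by
      refine (hK.norm_sub_le x a).trans ?_
      exact mul_le_mul_of_nonneg_left (Set.abs_sub_left_of_mem_uIcc hx) K.2)
    Set.left_mem_uIcc Set.right_mem_uIcc
  rw [Real.norm_eq_abs, Real.norm_eq_abs, mul_assoc, abs_mul_abs_self, ← sq] at this
  refine le_trans (le_of_eq ?_) this
  congr 1
  ring

/-- Expand both end values at the intermediate point `z`: the first-order terms cancel, since `a -
z` and `b - z` have weighted mean zero. -/
lemma abs_sub_interpolation_le (hd : ∀ x, HasDerivAt V (V' x) x) (hK : LipschitzWith K V')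
    (a b : ℝ) {θ : ℝ} (h0 : 0 ≤ θ) (h1 : θ ≤ 1) :
    |V ((1 - θ) * a + θ * b) - ((1 - θ) * V a + θ * V b)| ≤ K * (b - a) ^ 2 := by
  set z := (1 - θ) * a + θ * b with hz
  have ha := abs_taylor_one_le hd hK z a
  have hb := abs_taylor_one_le hd hK z b
  have ea : K * (a - z) ^ 2 ≤ K * (b - a) ^ 2 := by
    rw [show a - z = -θ * (b - a) by rw [hz]; ring, mul_pow, ← mul_assoc]
    have : (-θ) ^ 2 ≤ 1 := by nlinarith
    nlinarith [mul_nonneg K.coe_nonneg (sq_nonneg (b - a))]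
  have eb : K * (b - z) ^ 2 ≤ K * (b - a) ^ 2 := by
    rw [show b - z = (1 - θ) * (b - a) by rw [hz]; ring, mul_pow, ← mul_assoc]
    have : (1 - θ) ^ 2 ≤ 1 := by nlinarith
    nlinarith [mul_nonneg K.coe_nonneg (sq_nonneg (b - a))]
  have e : V z - ((1 - θ) * V a + θ * V b)
      = -((1 - θ) * (V a - V z - V' z * (a - z)) + θ * (V b - V z - V' z * (b - z))) := by
    rw [hz]; ring
  rw [e, abs_neg]
  refine (abs_add_le _ _).trans ?_
  rw [abs_mul, abs_mul, abs_of_nonneg h0, abs_of_nonneg (by linarith : 0 ≤ 1 - θ)]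
  nlinarith

/-- The remainder, as a function of the step `t`, vanishes with its first derivative at `0`, and its
second derivative `V(z+t) + V(z-t) - 2 V(z)` is at most `2 K h²` because the odd terms cancel. Two
mean value inequalities finish, without a fourth derivative. -/
lemma abs_second_difference_sub_le {w w' : ℝ → ℝ} (hw : ∀ x, HasDerivAt w (w' x) x)
    (hw' : ∀ x, HasDerivAt w' (V x) x) (hd : ∀ x, HasDerivAt V (V' x) x)
    (hK : LipschitzWith K V') (z : ℝ) {h : ℝ} (hh : 0 ≤ h) :
    |w (z + h) - 2 * w z + w (z - h) - h ^ 2 * V z| ≤ 2 * K * h ^ 4 := by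
  have shift : ∀ {f f' : ℝ → ℝ}, (∀ x, HasDerivAt f (f' x) x) → ∀ t,
      HasDerivAt (fun t => f (z + t)) (f' (z + t)) t ∧
      HasDerivAt (fun t => f (z - t)) (-f' (z - t)) t := by
    intro f f' hf t
    exact ⟨(hf (z + t)).comp_const_add z t, (hf (z - t)).comp_const_sub z t⟩
  have h2 : ∀ t ∈ Set.Icc 0 h, |V (z + t) + V (z - t) - 2 * V z| ≤ 2 * K * h ^ 2 := by
    intro t ht
    have h1 := abs_le.1 (abs_taylor_one_le hd hK z (z + t))
    have h2 := abs_le.1 (abs_taylor_one_le hd hK z (z - t))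
    have h3 : K * t ^ 2 ≤ K * h ^ 2 :=
      mul_le_mul_of_nonneg_left (pow_le_pow_left₀ ht.1 ht.2 2) K.2
    rw [show z + t - z = t by ring] at h1
    rw [show z - t - z = -t by ring, neg_sq] at h2
    rw [abs_le]
    constructor <;> linarith [h1.1, h1.2, h2.1, h2.2]
  have bound : ∀ {F F' : ℝ → ℝ} {C : ℝ}, 0 ≤ C → (∀ t, HasDerivAt F (F' t) t) →
      (∀ t ∈ Set.Icc 0 h, |F' t| ≤ C) → F 0 = 0 → ∀ t ∈ Set.Icc 0 h, |F t| ≤ C * h := by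
    intro F F' C hC hF hb h0 t ht
    have := (convex_Icc 0 h).norm_image_sub_le_of_norm_hasDerivWithin_le
      (fun t _ => (hF t).hasDerivWithinAt) hb (Set.left_mem_Icc.2 hh) ht
    rw [h0, sub_zero, sub_zero, Real.norm_eq_abs, Real.norm_eq_abs, abs_of_nonneg ht.1] at this
    exact this.trans (mul_le_mul_of_nonneg_left ht.2 hC)
  have hK0 : (0 : ℝ) ≤ K := K.2
  have h1 : ∀ t ∈ Set.Icc 0 h, |w' (z + t) - w' (z - t) - 2 * V z * t| ≤ 2 * K * h ^ 2 * h := by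
    refine bound (F' := fun t => V (z + t) + V (z - t) - 2 * V z) (by positivity) (fun t => ?_) h2
      (by simp)
    refine (((shift hw' t).1.sub (shift hw' t).2).sub
      ((hasDerivAt_id t).const_mul (2 * V z))).congr_deriv (by ring)
  have h0 := bound (F := fun t => w (z + t) + w (z - t) - 2 * w z - t ^ 2 * V z)
    (F' := fun t => w' (z + t) - w' (z - t) - 2 * V z * t) (C := 2 * K * h ^ 2 * h)
    (by positivity) (fun t => ?_) h1 (by simp; ring) h (Set.right_mem_Icc.2 hh)
  · refine le_trans (le_of_eq ?_) (h0.trans (le_of_eq (by ring)))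
    congr 1
    ring
  · refine ((((shift hw t).1.add (shift hw t).2).sub_const (2 * w z)).sub
      ((hasDerivAt_pow 2 t).mul_const (V z))).congr_deriv ?_
    simp
    ring

end Taylor

/-- The second derivative against the linear interpolant of second difference quotients. -/
lemma abs_sub_interpolated_difference_le {w w' V V' : ℝ → ℝ} {K : NNReal}
    (hw : ∀ x, HasDerivAt w (w' x) x) (hw' : ∀ x, HasDerivAt w' (V x) x)
    (hd : ∀ x, HasDerivAt V (V' x) x) (hK : LipschitzWith K V') {a b h θ : ℝ} (hh : 0 < h)
    (hab : (b - a) ^ 2 = h ^ 2) (h0 : 0 ≤ θ) (h1 : θ ≤ 1) :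
    |V ((1 - θ) * a + θ * b) - ((1 - θ) * ((w (a + h) - 2 * w a + w (a - h)) / h ^ 2)
      + θ * ((w (b + h) - 2 * w b + w (b - h)) / h ^ 2))| ≤ 3 * K * h ^ 2 := by
  have key : ∀ z, |V z - (w (z + h) - 2 * w z + w (z - h)) / h ^ 2| ≤ 2 * K * h ^ 2 := by
    intro z
    have := abs_second_difference_sub_le hw hw' hd hK z hh.le
    have e : V z - (w (z + h) - 2 * w z + w (z - h)) / h ^ 2
        = -((w (z + h) - 2 * w z + w (z - h) - h ^ 2 * V z) / h ^ 2) := by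
      field_simp
      ring
    rw [e, abs_neg, abs_div, abs_of_pos (by positivity : 0 < h ^ 2), div_le_iff₀ (by positivity)]
    exact this.trans (le_of_eq (by ring))
  -- The factor `3` is `1` from interpolating `V` plus `2` from the difference quotients at the
  -- nodes.
  have hi := abs_sub_interpolation_le hd hK a b h0 h1
  rw [hab] at hi
  have ha := abs_le.1 (key a)
  have hb := abs_le.1 (key b)
  have hi := abs_le.1 hi
  rw [abs_le]
  constructor <;> nlinarith

/-- Accuracy of the quadrature behind the scheme. -/
lemma abs_integral_sub_quadrature_le {α R : ℝ} (hα : 1 < α) (hα' : α < 2) {N : ℕ}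
    {w w' V V' : ℝ → ℝ} {K : NNReal} (hw : ∀ x, HasDerivAt w (w' x) x)
    (hw' : ∀ x, HasDerivAt w' (V x) x) (hd : ∀ x, HasDerivAt V (V' x) x)
    (hK : LipschitzWith K V') (x : ℝ) {h : ℝ} (hh : 0 < h) (hR : N * h = R) (q : ℕ → ℝ)
    (hq : ∀ j : ℕ, q j = (w (x + j * h + h) - 2 * w (x + j * h) + w (x + j * h - h))
      + (w (x - j * h + h) - 2 * w (x - j * h) + w (x - j * h - h))) :
    |(∫ y in (0 : ℝ)..R, y ^ (1 - α) * (V (x - y) + V (x + y)))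
      - h ^ (2 - α) / ((3 - α) * (2 - α)) / h ^ 2 * ∑ j ∈ Finset.range N,
        ((((j : ℝ) + 1) ^ (3 - α) - (j : ℝ) ^ (3 - α) - (3 - α) * (j : ℝ) ^ (2 - α)) * q j
        + ((j : ℝ) ^ (3 - α) - ((j : ℝ) + 1) ^ (3 - α) + (3 - α) * ((j : ℝ) + 1) ^ (2 - α))
          * q (j + 1))| ≤ 6 * K * R ^ (2 - α) / (2 - α) * h ^ 2 := by
  have hcV : Continuous V := continuous_iff_continuousAt.2 fun x => (hd x).continuousAt
  have hsum : ∀ {F : ℝ → ℝ}, (∀ a b, IntervalIntegrable F MeasureTheory.volume a b) →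
      ∫ y in (0 : ℝ)..R, F y
        = ∑ j ∈ Finset.range N, ∫ y in ((j : ℝ) * h)..((j + 1 : ℕ) * h), F y := by
    intro F hF
    rw [intervalIntegral.sum_integral_adjacent_intervals (a := fun k : ℕ => (k : ℝ) * h)
      (fun k _ => hF _ _), hR]
    simp
  have hW : ∀ a b, IntervalIntegrable (fun y => y ^ (1 - α) * (V (x - y) + V (x + y)))
      MeasureTheory.volume a b := fun a b => intervalIntegrable_kernel_mul hα' (by fun_prop)
  have hker : ∀ a b, IntervalIntegrable (fun y : ℝ => y ^ (1 - α) * (6 * K * h ^ 2))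
      MeasureTheory.volume a b := fun a b => intervalIntegrable_kernel_mul hα' continuous_const
  have hcell : ∀ j ∈ Finset.range N,
      |(∫ y in ((j : ℝ) * h)..((j + 1 : ℕ) * h), y ^ (1 - α) * (V (x - y) + V (x + y)))
        - h ^ (2 - α) / ((3 - α) * (2 - α)) / h ^ 2 *
        ((((j : ℝ) + 1) ^ (3 - α) - (j : ℝ) ^ (3 - α) - (3 - α) * (j : ℝ) ^ (2 - α)) * q j
        + ((j : ℝ) ^ (3 - α) - ((j : ℝ) + 1) ^ (3 - α) + (3 - α) * ((j : ℝ) + 1) ^ (2 - α))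
          * q (j + 1))|
      ≤ ∫ y in ((j : ℝ) * h)..((j + 1 : ℕ) * h), y ^ (1 - α) * (6 * K * h ^ 2) := by
    intro j _
    have hle : (j : ℝ) * h ≤ ((j + 1 : ℕ) : ℝ) * h := by push_cast; nlinarith
    have e := integral_kernel_mul_linear hα hα' hh j (q j / h ^ 2) (q (j + 1) / h ^ 2)
    have e' : h ^ (2 - α) / ((3 - α) * (2 - α)) / h ^ 2 *
        ((((j : ℝ) + 1) ^ (3 - α) - (j : ℝ) ^ (3 - α) - (3 - α) * (j : ℝ) ^ (2 - α)) * q j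
        + ((j : ℝ) ^ (3 - α) - ((j : ℝ) + 1) ^ (3 - α) + (3 - α) * ((j : ℝ) + 1) ^ (2 - α))
          * q (j + 1))
        = ∫ y in ((j : ℝ) * h)..((j + 1 : ℕ) * h), y ^ (1 - α)
          * (((j : ℝ) + 1 - y / h) * (q j / h ^ 2) + (y / h - j) * (q (j + 1) / h ^ 2)) := by
      rw [e]
      ring
    rw [e', ← intervalIntegral.integral_sub (hW _ _)
      (intervalIntegrable_kernel_mul hα' (by fun_prop)), ← Real.norm_eq_abs]
    refine intervalIntegral.norm_integral_le_of_norm_le hle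
      (Filter.Eventually.of_forall fun y hy => ?_) (hker _ _)
    have hy0 : 0 ≤ y := le_trans (by positivity) hy.1.le
    rw [← mul_sub, norm_mul, Real.norm_of_nonneg (Real.rpow_nonneg hy0 _)]
    refine mul_le_mul_of_nonneg_left ?_ (Real.rpow_nonneg hy0 _)
    -- `θ = y / h - j` is the local coordinate in the cell; it serves both branches `x - y` and `x +
    -- y`, each contributing `3 K h²`.
    have hθ0 : 0 ≤ y / h - j := by
      rw [sub_nonneg, le_div_iff₀ hh]
      exact hy.1.le
    have hθ1 : y / h - j ≤ 1 := by
      rw [sub_le_iff_le_add, div_le_iff₀ hh]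
      have := hy.2
      push_cast at this
      linarith
    have hyθ : y = (1 - (y / h - j)) * (j * h) + (y / h - j) * ((j + 1 : ℕ) * h) := by
      push_cast
      field_simp
      ring
    have h1 := abs_sub_interpolated_difference_le hw hw' hd hK (a := x - j * h)
      (b := x - (j + 1 : ℕ) * h) hh (by push_cast; ring) hθ0 hθ1
    have h2 := abs_sub_interpolated_difference_le hw hw' hd hK (a := x + j * h)
      (b := x + (j + 1 : ℕ) * h) hh (by push_cast; ring) hθ0 hθ1
    rw [show (1 - (y / h - j)) * (x - j * h) + (y / h - j) * (x - (j + 1 : ℕ) * h) = x - y by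
      linear_combination hyθ] at h1
    rw [show (1 - (y / h - j)) * (x + j * h) + (y / h - j) * (x + (j + 1 : ℕ) * h) = x + y by
      linear_combination -hyθ] at h2
    rw [hq j, hq (j + 1), Real.norm_eq_abs]
    refine le_trans (le_of_eq ?_)
      ((abs_add_le _ _).trans ((add_le_add h1 h2).trans (le_of_eq (by ring))))
    congr 1
    ring
  rw [hsum hW, Finset.mul_sum, ← Finset.sum_sub_distrib]
  refine (Finset.abs_sum_le_sum_abs _ _).trans ((Finset.sum_le_sum hcell).trans (le_of_eq ?_))
  rw [← hsum hker, intervalIntegral.integral_mul_const, integral_rpow (Or.inl (by linarith)),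
    show 1 - α + 1 = 2 - α by ring, Real.zero_rpow (by linarith)]
  ring

/-- Consistency of the discrete Riesz operator. -/
theorem abs_discRiesz_sub_rieszDeriv_le {α R : ℝ} (hα : 1 < α) (hα' : α < 2) (hR : 0 < R)
    {v : ℝ → ℝ} {K : NNReal} (hv : ContDiff ℝ 3 ((Set.Icc 0 R).indicator v))
    (hK : LipschitzWith K (iteratedDeriv 3 ((Set.Icc 0 R).indicator v))) {N i : ℕ}
    (hi : i ∈ Finset.Ico 1 N) :
    |discRiesz α (R / N) N (fun m => v (m * (R / N))) i - rieszDeriv α R v (i * (R / N))|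
      ≤ kappa α / Real.Gamma (2 - α) * (6 * K * R ^ (2 - α) / (2 - α)) * (R / N) ^ 2 := by
  have hi' := Finset.mem_Ico.1 hi
  have hN0 : (0 : ℝ) < N := by exact_mod_cast (by omega : 0 < N)
  have hi0 : (0 : ℝ) < i := by exact_mod_cast hi'.1
  have hiN : (i : ℝ) < N := by exact_mod_cast hi'.2
  have hNR : (N : ℝ) * (R / N) = R := mul_div_cancel₀ _ hN0.ne'
  have hh : 0 < R / N := by positivity
  set h := R / N
  set w := (Set.Icc 0 R).indicator v with hwdef
  have hder : ∀ m < 3, ∀ x, HasDerivAt (iteratedDeriv m w) (iteratedDeriv (m + 1) w x) x := by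
    intro m hm x
    rw [iteratedDeriv_succ]
    exact (hv.differentiable_iteratedDeriv m (by exact_mod_cast hm) x).hasDerivAt
  have hw := hder 0 (by norm_num)
  rw [iteratedDeriv_zero] at hw
  have hw' := hder 1 (by norm_num)
  have hd := hder 2 (by norm_num)
  have hcw : Continuous w := hv.continuous
  have hc : ∀ m ≤ 2, Continuous (iteratedDeriv m w) := fun m hm =>
    hv.continuous_iteratedDeriv m (by exact_mod_cast hm.trans (by norm_num))
  have hbdd : ∀ m ≤ 2, ∃ M, ∀ x, |iteratedDeriv m w x| ≤ M := by
    intro m hm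
    obtain ⟨M, hM⟩ := isCompact_Icc.exists_bound_of_continuousOn (s := Set.Icc 0 R)
      (hc m hm).continuousOn
    refine ⟨M, fun x => ?_⟩
    by_cases hx : x ∈ Set.Icc 0 R
    · exact hM x hx
    · have : w =ᶠ[nhds x] fun _ => 0 := by
        filter_upwards [isClosed_Icc.isOpen_compl.mem_nhds hx] with z hz
        exact Set.indicator_of_notMem hz v
      rw [this.iteratedDeriv_eq]
      have h0 : (0 : ℝ) ≤ M := (norm_nonneg _).trans (hM 0 ⟨le_rfl, hR.le⟩)
      rcases m with _ | m <;> simpa using h0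
  obtain ⟨M₁, hM₁⟩ := hbdd 1 (by norm_num)
  obtain ⟨M₂, hM₂⟩ := hbdd 2 le_rfl
  -- The indicator is zero only strictly outside `[0, R]`; continuity extends this to the endpoints.
  have hclosed : IsClosed {x | w x = 0} := isClosed_eq hcw continuous_const
  have hl : ∀ x, x ≤ 0 → w x = 0 := by
    have : Set.Iio 0 ⊆ {x | w x = 0} := fun x hx =>
      Set.indicator_of_notMem (fun hm => (not_le.2 hx) hm.1) v
    have := hclosed.closure_subset_iff.2 this
    rw [closure_Iio] at this
    exact fun x hx => this hx
  have hr : ∀ x, N * h ≤ x → w x = 0 := by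
    have : Set.Ioi R ⊆ {x | w x = 0} := fun x hx =>
      Set.indicator_of_notMem (fun hm => (not_le.2 hx) hm.2) v
    have := hclosed.closure_subset_iff.2 this
    rw [closure_Ioi] at this
    exact fun x hx => this (hNR ▸ hx)
  have hx : (i : ℝ) * h ∈ Set.Ioo 0 R := ⟨by positivity, by nlinarith⟩
  have hvw : ∀ m ∈ Finset.range (N + 1), g₂ α i m * v (m * h) = g₂ α i m * w (m * h) := by
    intro m hm
    have hmN : (m : ℝ) ≤ N := by exact_mod_cast Nat.lt_succ_iff.1 (Finset.mem_range.1 hm)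
    rw [hwdef, Set.indicator_of_mem (show (m : ℝ) * h ∈ Set.Icc 0 R from
      ⟨by positivity, by nlinarith⟩)]
  rw [discRiesz, Finset.sum_congr rfl hvw, sum_g₂_mul_eq α hi w hl hr hh.le,
    rieszDeriv_eq (M := max M₁ M₂) hα' hw hw' (hc 2 le_rfl) (fun x => (hM₁ x).trans
      (le_max_left _ _)) (fun x => (hM₂ x).trans (le_max_right _ _)) hx]
  obtain ⟨n, rfl⟩ : ∃ n, N = n + 1 := ⟨N - 1, by omega⟩
  set x := (i : ℝ) * h
  set p : ℕ → ℝ := fun j => w (x - j * h) + w (x + j * h) with hp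
  set q : ℕ → ℝ := fun j => (w (x + j * h + h) - 2 * w (x + j * h) + w (x + j * h - h))
      + (w (x - j * h + h) - 2 * w (x - j * h) + w (x - j * h - h)) with hq
  have hq0 : q 0 = 2 * p 1 - 2 * p 0 := by
    simp only [hq, hp, Nat.cast_zero, zero_mul, Nat.cast_one, one_mul, add_zero, sub_zero]
    ring
  have hqs : ∀ j, q (j + 1) = p (j + 2) - 2 * p (j + 1) + p j := by
    intro j
    simp only [hq, hp]
    rw [show x + ((j + 1 : ℕ) : ℝ) * h + h = x + ((j + 2 : ℕ) : ℝ) * h by push_cast; ring,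
      show x + ((j + 1 : ℕ) : ℝ) * h - h = x + (j : ℝ) * h by push_cast; ring,
      show x - ((j + 1 : ℕ) : ℝ) * h + h = x - (j : ℝ) * h by push_cast; ring,
      show x - ((j + 1 : ℕ) : ℝ) * h - h = x - ((j + 2 : ℕ) : ℝ) * h by push_cast; ring]
    ring
  -- From offset `n = N - 1` on, both sample points `x ± j h` lie outside the open interval, so all
  -- boundary terms of the summation by parts disappear.
  have hp0 : ∀ j, n ≤ j → p j = 0 := by
    intro j hj
    have h1 : (i : ℝ) ≤ j := by exact_mod_cast (by omega : i ≤ j)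
    have h2 : ((n + 1 : ℕ) : ℝ) ≤ i + j := by exact_mod_cast (by omega : n + 1 ≤ i + j)
    simp only [hp]
    rw [hl _ (by simp only [x]; nlinarith), hr _ (by simp only [x]; nlinarith), add_zero]
  have hsum := sum_quadrature_eq hα' p q hq0 hqs n
  rw [hqs, hp0 n le_rfl, hp0 (n + 1) (by omega), hp0 (n + 2) (by omega)] at hsum
  have hsum' : g α 1 * (w x + w x) + ∑ j ∈ Finset.Ico 1 (n + 1),
      offDiag α j * (w (x - j * h) + w (x + j * h)) = g α 1 * p 0
        + ∑ j ∈ Finset.Ico 1 (n + 1), offDiag α j * p j := by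
    simp [hp]
  have herr := abs_integral_sub_quadrature_le hα hα' hw hw' hd hK x hh hNR q
    (fun j => rfl)
  rw [hsum] at herr
  rw [hsum']
  have hκ := kappa_pos hα hα'
  have hG2 : 0 < Real.Gamma (2 - α) := Real.Gamma_pos_of_pos (by linarith)
  have hG : Real.Gamma (4 - α) = (3 - α) * ((2 - α) * Real.Gamma (2 - α)) := by
    have h3 := Real.Gamma_add_one (s := 2 - α) (by linarith)
    have h4 := Real.Gamma_add_one (s := 3 - α) (by linarith)
    rw [show 2 - α + 1 = 3 - α by ring] at h3
    rw [show 3 - α + 1 = 4 - α by ring] at h4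
    rw [h4, h3]
  have hcoef : kappa α / (Real.Gamma (4 - α) * h ^ α)
      = kappa α / Real.Gamma (2 - α) * (h ^ (2 - α) / ((3 - α) * (2 - α)) / h ^ 2) := by
    have h2 : 2 - α ≠ 0 := by linarith
    have h3 : 3 - α ≠ 0 := by linarith
    have := Real.rpow_pos_of_pos hh α
    rw [hG, Real.rpow_sub hh, Real.rpow_two]
    field_simp
  rw [hcoef, mul_assoc, ← mul_sub, abs_mul, abs_of_pos (div_pos hκ hG2), mul_assoc, abs_sub_comm]
  refine mul_le_mul_of_nonneg_left (le_trans (le_of_eq ?_) herr) (div_pos hκ hG2).le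
  congr 2
  ring

/-! ### Second order consistency of the full scheme. -/

/-- Second order consistency of the scheme for smooth solutions. -/
theorem exists_truncBound {α γ xR T : ℝ} (hα : 1 < α) (hα' : α < 2) (hγ : 0 < γ) (hγ' : γ < 1)
    (hxR : 0 < xR) (hT : 0 < T) {f : ℝ → ℝ → ℝ} {u₀ : ℝ → ℝ} {u : ℝ → ℝ → ℝ}
    (hu : IsSolution α γ xR T f u₀ u) (hs : IsSmooth xR T u) :
    ∃ C : ℝ, 0 < C ∧ ∀ (τ : ℝ) (Nx N : ℕ), 0 < τ → 1 ≤ Nx → 1 ≤ N → N * τ ≤ T →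
      TruncBound α γ xR f u C τ Nx N := by
  obtain ⟨K, ht, hx⟩ := hs
  have hκ := kappa_pos hα hα'
  have hG2 : 0 < Real.Gamma (2 - α) := Real.Gamma_pos_of_pos (by linarith)
  have hσ := sigma_pos hγ hγ'
  have h1γ : 0 < 1 - γ := by linarith
  have h2α : 0 < 2 - α := by linarith
  set A := 1 / (1 - γ) * (K * sigma γ * T)
  set B := kappa α / Real.Gamma (2 - α) * (6 * K * xR ^ (2 - α) / (2 - α))
  have hA : 0 ≤ A := by positivity
  have hB : 0 ≤ B := by positivity
  -- The summand `1` keeps the constant positive when `K = 0`.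
  refine ⟨A + B + 1, by linarith, fun τ Nx N hτ hNx _ hNT n hn i hi => ?_⟩
  have hn' := Finset.mem_Icc.1 hn
  have hi' := Finset.mem_Ico.1 hi
  have hNx0 : (0 : ℝ) < Nx := by exact_mod_cast hNx
  have hi0 : (0 : ℝ) < i := by exact_mod_cast hi'.1
  have hiN : (i : ℝ) < Nx := by exact_mod_cast hi'.2
  have hn0 : (0 : ℝ) < n := by exact_mod_cast hn'.1
  have hnN : (n : ℝ) ≤ N := by exact_mod_cast hn'.2
  have hnT : n * τ ≤ T := (mul_le_mul_of_nonneg_right hnN hτ.le).trans hNT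
  have hnt : (n : ℝ) * τ ∈ Set.Ioc 0 T := ⟨by positivity, hnT⟩
  have hxi : (i : ℝ) * (xR / Nx) ∈ Set.Ioo 0 xR := ⟨by positivity, by
    rw [← mul_div_assoc, div_lt_iff₀ hNx0]; nlinarith⟩
  have h1 := ht _ (Set.Ioo_subset_Icc_self hxi)
  have h2 := hx _ (Set.Ioc_subset_Icc_self hnt)
  have e1 := abs_discCF_sub_cfDeriv_le hγ hγ' hτ h1.1 h1.2 hn'.1 hnT
  have e2 := abs_discRiesz_sub_rieszDeriv_le hα hα' hxR h2.1 h2.2 hi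
  have heq := hu.equation _ hxi _ hnt
  have e : truncErr α γ xR f u τ Nx n i
      = (discCF γ τ (fun k => u (i * (xR / Nx)) (k * τ)) n
          - cfDeriv γ (u (i * (xR / Nx))) (n * τ))
        - (discRiesz α (xR / Nx) Nx (fun m => u (m * (xR / Nx)) (n * τ)) i
          - rieszDeriv α xR (fun y => u y (n * τ)) (i * (xR / Nx))) := by
    rw [heq, truncErr]
    ring
  rw [e]
  refine (abs_sub _ _).trans ((add_le_add e1 e2).trans ?_)
  have := sq_nonneg τ
  have := sq_nonneg (xR / Nx)
  nlinarith [mul_nonneg hA this, mul_nonneg hB (sq_nonneg τ)]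

end CFRiesz

end

theorem theorem3p2 (α γ xR T : ℝ) (hα : 1 < α) (hα' : α < 2) (hγ : 0 < γ) (hγ' : γ < 1)
    (hxR : 0 < xR) (hT : 0 < T) (f : ℝ → ℝ → ℝ) (u₀ : ℝ → ℝ) (u : ℝ → ℝ → ℝ)
    (hu : CFRiesz.IsSolution α γ xR T f u₀ u) :
    (CFRiesz.IsSmooth xR T u →
      ∃ C : ℝ, 0 < C ∧ ∀ (τ : ℝ) (Nx N : ℕ), 0 < τ → 1 ≤ Nx → 1 ≤ N → N * τ ≤ T →
        CFRiesz.TruncBound α γ xR f u C τ Nx N) ∧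
    (∀ C : ℝ, 0 < C → ∀ (τ : ℝ) (Nx N : ℕ), 0 < τ → 1 ≤ Nx → 1 ≤ N → N * τ ≤ T →
      CFRiesz.TruncBound α γ xR f u C τ Nx N →
      ∀ U : ℕ → ℕ → ℝ, CFRiesz.IsSchemeSolution α γ xR f u₀ τ Nx N U →
        τ * ∑ n ∈ Finset.Icc 1 N,
            CFRiesz.gridNorm (xR / Nx) Nx (fun i => u (i * (xR / Nx)) (n * τ) - U n i)
          ≤ |Real.Gamma (1 - α)| * Real.Gamma (4 - α) * xR ^ (α + 1 / 2) * T
              / (√2 * CFRiesz.kappa α) * C * (τ ^ 2 + (xR / Nx) ^ 2)) :=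
  ⟨CFRiesz.exists_truncBound hα hα' hγ hγ' hxR hT hu,
    fun _ hC _ _ _ hτ hNx _ hNT hr _ hU =>
      CFRiesz.error_bound hα hα' hγ hγ' hxR hu hC hτ hNx hNT hr hU⟩
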